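/- **Model.** Parameters: densities $\lambda_b,\lambda_o>0$, RIS fraction $\mu\in[0,1]$, $\lambda_r=\mu\lambda_o$, mean obstacle length $L_o>0$, $\beta=2\lambda_oL_o/\pi$, path-loss exponents $\alpha_L,\alpha_N>0$, Nakagami parameters $m_L,m_N\in\{1,2,\dots\}$, numbers of BS antennas and RIS elements $N_b,N_r\ge 1$ with $G_b=N_b$, $G_r=N_r^2$, reference path loss $\zeta=(\lambda_f/4\pi)^2$, noise power $\sigma'^2>0$, power-control constants $p_0,p_{\max}>0$, $\epsilon\in(0,1]$, reference SAR $\mathrm{SAR}_{\rm ref}>0$. A link of length $t$ is LoS with probability $P_L(t)=e^{-\beta t}$ (independently over links) and NLoS with probability $P_N=1-P_L$. The typical user is at the origin; BSs and RISs are independent homogeneous Poisson processes of densities $\lambda_b,\lambda_r$. The user is served by its nearest BS, at distance $t_{bu}$: by a direct LoS link ($q=\mathrm{DL}$) if the direct link is LoS; otherwise by a cascaded link ($q=\mathrm{CL}$) through the nearest RIS, at distance $t_{ru}$, whose link to the user is LoS and that has, with its uniformly distributed orientation, both the user and the BS on its front side, if there is such a RIS (the BS-RIS link is always LoS); otherwise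 by a direct NLoS link ($q=\mathrm{DN}$). The BS-RIS distance is $t_{br}=\sqrt{t_{bu}^2+t_{ru}^2-2t_{bu}t_{ru}\cos\theta_0}$, where $\theta_0\sim\mathcal U(-\pi,\pi)$ is modelled as independent of all other random objects. Put $\mathcal T_{DL}=\mathcal T_{DN}=\{t_{bu}\}$ and $\mathcal T_{CL}=\{t_{bu},t_{ru},t_{br}\}$. With $T_{\max}=(p_{\max}/p_0)^{1/(\alpha_L\epsilon)}$, the transmit power $p_{u,q}$ is $p_0t_{bu}^{\alpha_L\epsilon}$ if $t_{bu}<T_{\max}$ (DL), $p_0t_{bu}^{\alpha_N\epsilon}$ if $t_{bu}<T_{\max}^{\alpha_L/\alpha_N}$ (DN), $p_0((t_{br}t_{ru})^{\alpha_L}G_r^{-1})^{\epsilon}$ if $t_{br}t_{ru}<T_{\max}G_r^{1/\alpha_L}$ (CL), and $p_{\max}$ otherwise. The received power $P'_q$ is $p_{u,DL}G_b\zeta t_{bu}^{-\alpha_L}H'_{DL}$, $p_{u,CL}G_rG_b\zeta(t_{ru}t_{br})^{-\alpha_L}H'_{CL}$, $p_{u,DN}G_b\zeta t_{bu}^{-\alpha_N}H'_{DN}$,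 respectively, where $H'_q$ is gamma distributed with shape $m_q$ and mean $1$ ($m_{DL}=m_{CL}=m_L$, $m_{DN}=m_N$). The SINR is $\Upsilon'_q=P'_q/(\sigma'^2+I_U)$ and the EMF exposure is $\mathcal W'_q=\mathrm{SAR}_{\rm ref}\,p_{u,q}$; $\Upsilon'$ and $\mathcal W'$ are $\Upsilon'_q$ and $\mathcal W'_q$ for the actual type $q$ of the serving link. The interference is $I_U=\sum_i p_{u,i}\,G_B(\Delta'_i)\,\zeta\, d_i'^{-\alpha_{v_i}}H'_{v_i,i}$, summed over a Poisson process of interfering users with density $\lambda_b(1-e^{-\pi\lambda_bd'^2})$ at distance $d'$ from the tagged BS, where independently for each user $v_i=L$ with probability $P_L(d_i')$ and $v_i=N$ otherwise, $p_{u,i}$ is distributed as the transmit power of the typical user, $\Delta'_i=\frac12\cos\phi_i-\frac12\cos\phi_i^*$ with independent uniform angles, and $H'_{v,i}$ is gamma distributed with shape $m_v$ and mean $1$. Here $G_B$ is the discrete multi-lobe pattern: for $|\Delta|\le\frac12$, with $G_{\rm ULA}(x)=\frac{\sin^2(\pi N_bx)}{N_b\sin^2(\pi x)}$ and a constant $\delta>0$,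 $G_B(\Delta)=\frac\delta2N_b$ if $|\Delta|\le\frac1{N_b}$, $G_B(\Delta)=\frac\delta2G_{\rm ULA}(\frac{2n+1}{2N_b})$ if $\frac n{N_b}<|\Delta|\le\frac{n+1}{N_b}$ with $1\le n\le\lfloor N_b/2\rfloor-1$, and $0$ otherwise; for $\frac12<|\Delta|\le1$, $G_B(\Delta)=G_B(1-|\Delta|)$. The BSs, the RISs, the LoS state of the direct link, $\theta_0$, the fading coefficients and the interfering users are independent. **Notation.** Let $P_R(x,t,\theta)=\frac12-\frac1{2\pi}\arccos\frac{t-x\cos\theta}{\sqrt{x^2+t^2-2xt\cos\theta}}$, $\bar a(x,t)=\int_{-\pi}^{\pi}P_L(t)P_R(x,t,\theta)\,d\theta$, $P_{CL}(x)=1-\exp(-\lambda_r\int_0^\infty\bar a(x,t)\,t\,dt)$, $\mathcal A_{DL}(x)=P_L(x)$, $\mathcal A_{CL}(x)=P_N(x)P_{CL}(x)$, $\mathcal A_{DN}(x)=P_N(x)(1-P_{CL}(x))$, $f_{T_{bu}}(x)=2\pi\lambda_bxe^{-\pi\lambda_bx^2}$, $f_{T_{ru}|x}(y)=\lambda_r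 y\,\bar a(x,y)\exp(-\lambda_r\int_0^y\bar a(x,t)\,t\,dt)/P_{CL}(x)$. For $\gamma',\omega'\in\mathbb R$ and deterministic distances $\tau$, let $\bar F_{\Upsilon'_q|\tau}(\gamma')$ be the probability, over fading and interference, that $\Upsilon'_q>\gamma'$ when the link distances are $\tau$, let $F_{\mathcal W'_q|\tau}(\omega')=\mathbf 1(\mathcal W'_q\le\omega')$ at the distances $\tau$, and $J_{q|\tau}=\bar F_{\Upsilon'_q|\tau}(\gamma')\,F_{\mathcal W'_q|\tau}(\omega')$. **Theorem 6 (Uplink Joint Probability).** For all $\gamma',\omega'\in\mathbb R$ and each $q\in\{\mathrm{DL,CL,DN}\}$, almost surely, $\mathbb P(\Upsilon'_q>\gamma'\mid\mathcal T_q)=\bar F_{\Upsilon'_q|\mathcal T_q}(\gamma')$, $\mathbb P(\mathcal W'_q\le\omega'\mid\mathcal T_q)=F_{\mathcal W'_q|\mathcal T_q}(\omega')$ and $$\mathbb P(\Upsilon'_q>\gamma',\mathcal W'_q\le\omega'\mid\mathcal T_q)=\bar F_{\Upsilon'_q|\mathcal T_q}(\gamma')\,F_{\mathcal W'_q|\mathcal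 T_q}(\omega').$$ Moreover $\mathbb P(\Upsilon'>\gamma',\mathcal W'\le\omega')=\mathbb E_{t_{bu},t_{ru},t_{br}}\big[\sum_q\mathcal A_q\,J_{q|\mathcal T_q}\big]$, that is, $$\mathbb P(\Upsilon'>\gamma',\mathcal W'\le\omega')=\int_0^\infty\Big[\mathcal A_{DL}J_{DL|t_{bu}}+\int_0^\infty\!\!\int_{-\pi}^{\pi}\mathcal A_{CL}\,J_{CL|t_{bu},t_{ru},t_{br}}\,\tfrac1{2\pi}f_{T_{ru}|t_{bu}}(t_{ru})\,d\theta_0\,dt_{ru}+\mathcal A_{DN}J_{DN|t_{bu}}\Big]f_{T_{bu}}(t_{bu})\,dt_{bu},$$ where $t_{br}=\sqrt{t_{bu}^2+t_{ru}^2-2t_{bu}t_{ru}\cos\theta_0}$ and $\mathcal A_q=\mathcal A_q(t_{bu})$. (When $P_{CL}(t_{bu})=0$ the CL term is $0$.) -/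

import Mathlib

open MeasureTheory ProbabilityTheory
open scoped ENNReal NNReal

namespace RISNet

noncomputable section

/-! ## System parameters and deterministic functions of the model -/

/-- The three types of serving links: direct LoS, cascaded LoS (through a RIS), direct NLoS. -/
inductive LinkType
  | DL
  | CL
  | DN
  deriving DecidableEq

instance : MeasurableSpace LinkType := ⊤

/-- The parameters of the network. -/
structure Params where
  /-- density of the base stations -/
  lamB : ℝ
  /-- density of the obstacles -/
  lamO : ℝ
  /-- fraction of the obstacles that carry a RIS -/
  mu : ℝ
  /-- average length of an obstacle -/
  Lo : ℝ
  /-- path-loss exponents of LoS and NLoS links -/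
  alphaL : ℝ
  alphaN : ℝ
  /-- Nakagami shaping parameters of LoS and NLoS links -/
  mL : ℕ
  mN : ℕ
  /-- number of antennas of a base station, number of elements of a RIS -/
  Nb : ℕ
  Nr : ℕ
  /-- wavelength of the carrier -/
  wavelength : ℝ
  /-- roll-off compensation factor of the multi-lobe antenna pattern -/
  delta : ℝ
  /-- power control: base power, maximum power and power control factor -/
  p0 : ℝ
  pmax : ℝ
  eps : ℝ
  /-- noise power at a base station -/
  noise : ℝ
  /-- reference SAR per transmit power -/
  sarRef : ℝ
  lamB_pos : 0 < lamB
  lamO_pos : 0 < lamO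
  mu_nonneg : 0 ≤ mu
  mu_le_one : mu ≤ 1
  Lo_pos : 0 < Lo
  alphaL_pos : 0 < alphaL
  alphaN_pos : 0 < alphaN
  mL_pos : 0 < mL
  mN_pos : 0 < mN
  Nb_pos : 0 < Nb
  Nr_pos : 0 < Nr
  wavelength_pos : 0 < wavelength
  delta_pos : 0 < delta
  p0_pos : 0 < p0
  pmax_pos : 0 < pmax
  eps_pos : 0 < eps
  eps_le_one : eps ≤ 1
  noise_pos : 0 < noise
  sarRef_pos : 0 < sarRef

/-- Distances of a serving link: `(BS-user, RIS-user, BS-RIS)`. The last two are only meaningful for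
a cascaded link. -/
abbrev Distances := ℝ × ℝ × ℝ

namespace Params

variable (p : Params)

/-- Density of the RISs. -/
def lamR : ℝ := p.mu * p.lamO

/-- Blockage parameter. -/
def beta : ℝ := 2 * p.lamO * p.Lo / Real.pi

/-- Probability that a link of length `t` is LoS. -/
def probLoS (t : ℝ) : ℝ := Real.exp (-p.beta * t)

/-- Probability that a link of length `t` is NLoS. -/
def probNLoS (t : ℝ) : ℝ := 1 - p.probLoS t

/-- Reference path loss. -/
def zeta : ℝ := (p.wavelength / (4 * Real.pi)) ^ 2

/-- Maximum gain of a base station antenna. -/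
def Gb : ℝ := p.Nb

/-- Gain of a RIS. -/
def Gr : ℝ := (p.Nr : ℝ) ^ 2

/-- Gain of the uniform linear array, extended by continuity where `sin (π x) = 0`. -/
def gainULA (x : ℝ) : ℝ :=
  if Real.sin (Real.pi * x) = 0 then (p.Nb : ℝ)
  else Real.sin (Real.pi * p.Nb * x) ^ 2 / (p.Nb * Real.sin (Real.pi * x) ^ 2)

/-- The discrete multi-lobe antenna pattern on folded deviations `0 ≤ y ≤ 1/2`: the value is
`δ/2 · gainULA 0` on `[0, 1/Nb]`, `δ/2 · gainULA ((2n+1)/(2Nb))` on `(n/Nb, (n+1)/Nb]` for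
`1 ≤ n ≤ ⌊Nb/2⌋ - 1`, and `0` elsewhere. -/
def gainLobe (y : ℝ) : ℝ :=
  if y ≤ 1 / p.Nb then p.delta / 2 * p.gainULA 0
  else ∑ n ∈ Finset.Icc 1 (p.Nb / 2 - 1),
    if (n : ℝ) / p.Nb < y ∧ y ≤ ((n : ℝ) + 1) / p.Nb
    then p.delta / 2 * p.gainULA ((2 * (n : ℝ) + 1) / (2 * p.Nb)) else 0

/-- The discrete multi-lobe antenna pattern as a function of the spatial AoD deviation
`Δ ∈ [-1, 1]`. -/
def gainB (Δ : ℝ) : ℝ :=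
  if |Δ| ≤ 1 / 2 then p.gainLobe |Δ| else p.gainLobe (1 - |Δ|)

/-! ### Association probabilities and distance distributions -/

/-- Probability that a RIS at distance `t` and angle `θ` (seen from the user, measured from the
user-BS direction) has both the user and the BS on its front side. -/
def probReflect (tbu t θ : ℝ) : ℝ :=
  1 / 2 - 1 / (2 * Real.pi) *
    Real.arccos ((t - tbu * Real.cos θ) /
      Real.sqrt (tbu ^ 2 + t ^ 2 - 2 * tbu * t * Real.cos θ))

/-- Probability that a RIS at distance `t` and angle `θ` provides a cascaded LoS link. -/
def a (tbu t θ : ℝ) : ℝ := p.probLoS t * probReflect tbu t θ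

/-- `a` integrated over the angle. -/
def abar (tbu t : ℝ) : ℝ := ∫ θ in (-Real.pi)..Real.pi, p.a tbu t θ

/-- Probability that a cascaded LoS link exists, given the BS-user distance. -/
def probCL (tbu : ℝ) : ℝ :=
  1 - Real.exp (-p.lamR * ∫ t in Set.Ioi (0 : ℝ), p.abar tbu t * t)

/-- Association probabilities, given the BS-user distance. -/
def assoc : LinkType → ℝ → ℝ
  | .DL, tbu => p.probLoS tbu
  | .CL, tbu => p.probNLoS tbu * p.probCL tbu
  | .DN, tbu => p.probNLoS tbu * (1 - p.probCL tbu)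

/-- Density of the BS-user distance. -/
def pdfBU (tbu : ℝ) : ℝ :=
  2 * Real.pi * p.lamB * tbu * Real.exp (-Real.pi * p.lamB * tbu ^ 2)

/-- Density of the RIS-user distance of a cascaded link, given the BS-user distance. -/
def pdfRU (tbu tru : ℝ) : ℝ :=
  p.lamR * tru * p.abar tbu tru * Real.exp (-p.lamR * ∫ t in (0 : ℝ)..tru, p.abar tbu t * t) /
    p.probCL tbu

/-- BS-RIS distance as a function of the two other distances and the angle between the user-BS and
the user-RIS links. -/
def distBR (tbu tru θ : ℝ) : ℝ :=
  Real.sqrt (tbu ^ 2 + tru ^ 2 - 2 * tbu * tru * Real.cos θ)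

/-! ### Uplink power control, received power and exposure -/

/-- Distance threshold of the power control on a direct LoS link. -/
def Tmax : ℝ := (p.pmax / p.p0) ^ (1 / (p.alphaL * p.eps))

/-- Uplink transmit power of a user served by a link of the given type and distances. -/
def power : LinkType → Distances → ℝ
  | .DL, (tbu, _, _) =>
      if tbu < p.Tmax then p.p0 * tbu ^ (p.alphaL * p.eps) else p.pmax
  | .CL, (_, tru, tbr) =>
      if tbr * tru < p.Tmax * p.Gr ^ (1 / p.alphaL)
      then p.p0 * ((tbr * tru) ^ p.alphaL * p.Gr⁻¹) ^ p.eps else p.pmax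
  | .DN, (tbu, _, _) =>
      if tbu < p.Tmax ^ (p.alphaL / p.alphaN) then p.p0 * tbu ^ (p.alphaN * p.eps) else p.pmax

/-- Received serving signal power at the tagged BS, when the fading coefficient is `h`. -/
def received : LinkType → Distances → ℝ → ℝ
  | .DL, (tbu, tru, tbr), h =>
      p.power .DL (tbu, tru, tbr) * p.Gb * p.zeta * tbu ^ (-p.alphaL) * h
  | .CL, (tbu, tru, tbr), h =>
      p.power .CL (tbu, tru, tbr) * p.Gr * p.Gb * p.zeta * (tru * tbr) ^ (-p.alphaL) * h
  | .DN, (tbu, tru, tbr), h =>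
      p.power .DN (tbu, tru, tbr) * p.Gb * p.zeta * tbu ^ (-p.alphaN) * h

/-- Uplink EMF exposure (SAR) of a user served by a link of the given type and distances. -/
def exposure (q : LinkType) (d : Distances) : ℝ := p.sarRef * p.power q d

/-- Nakagami shaping parameter of a serving link. -/
def shape : LinkType → ℕ
  | .DL => p.mL
  | .CL => p.mL
  | .DN => p.mN

/-- Density of the interfering users at distance `d` from the tagged BS. -/
def lamIU (d : ℝ) : ℝ := p.lamB * (1 - Real.exp (-Real.pi * p.lamB * d ^ 2))

end Params

/-! ## Random objects -/

/-- The uniform distribution on `[a, b]`. -/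
def unif (a b : ℝ) : Measure ℝ := ProbabilityTheory.cond volume (Set.Icc a b)

/-- The law of the small-scale (power) fading coefficient with shaping parameter `m` and mean one:
density `m ^ m * h ^ (m - 1) * exp (-m h) / Γ(m)` on `h > 0`. -/
def fadingLaw (m : ℕ) : Measure ℝ := gammaMeasure m m

/-- `Ψ` is a Poisson point process on `E` with intensity measure `Λ`, as a random integer-valued
measure. The map `pos` gives the planar position of a (marked) point; there are finitely many points
with position in any bounded set. -/
structure IsPoissonProcess {Ω : Type*} [MeasurableSpace Ω] {E : Type*} [MeasurableSpace E]
    (pos : E → ℂ) (Ψ : Ω → Measure E) (Λ : Measure E) (P : Measure Ω) : Prop where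
  measurable : Measurable Ψ
  integer_valued : ∀ ω (B : Set E), MeasurableSet B → ∃ n : ℕ∞, Ψ ω B = (n : ℝ≥0∞)
  locally_finite : ∀ ω (R : ℝ), Ψ ω {x | ‖pos x‖ ≤ R} < ∞
  poisson : ∀ B : Set E, MeasurableSet B → Λ B < ∞ →
    P.map (fun ω => Ψ ω B) = (poissonMeasure (Λ B).toNNReal).map (fun n : ℕ => (n : ℝ≥0∞))
  indep : ∀ (n : ℕ) (B : Fin n → Set E), (∀ i, MeasurableSet (B i)) →
    Pairwise (fun i j => Disjoint (B i) (B j)) → iIndepFun (fun i ω => Ψ ω (B i)) P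

/-- A RIS: its position (in the plane with the typical user at the origin and the tagged BS on the
positive real axis), the direction of the normal of its front side, and a mark in `[0, 1]` that
decides whether the user-RIS link is LoS. -/
abbrev RIS := ℂ × ℝ × ℝ

/-- The point `y` lies on the front side of a RIS at `x` with normal direction `φ`. -/
def InFront (x : ℂ) (φ : ℝ) (y : ℂ) : Prop :=
  0 < (y.re - x.re) * Real.cos φ + (y.im - x.im) * Real.sin φ

/-- The RISs that provide a cascaded LoS link when the BS is at distance `tbu`: the user-RIS link is
LoS (the BS-RIS link always is), and the user and the BS are on the front side. -/
def eligible (p : Params) (tbu : ℝ) : Set RIS :=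
  {r | r.2.2 ≤ p.probLoS ‖r.1‖ ∧ InFront r.1 r.2.1 0 ∧ InFront r.1 r.2.1 (tbu : ℂ)}

/-- An active user other than the typical one, seen from the tagged BS: position relative to the
tagged BS; type and distances of its own serving link; a mark in `[0, 1]` that decides whether its
link to the tagged BS is LoS; the physical AoD towards it and the physical AoD of the beam; the
fading coefficients of its link to the tagged BS in the LoS and in the NLoS case. -/
abbrev Interferer := ℂ × (LinkType × Distances) × ℝ × (ℝ × ℝ) × (ℝ × ℝ)

/-- Interfering power that an active user causes at the tagged BS. -/
def interfPower (p : Params) : Interferer → ℝ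
  | (x, (q, d), u, (φ, φb), (hL, hN)) =>
    p.power q d * p.gainB (1 / 2 * Real.cos φ - 1 / 2 * Real.cos φb) * p.zeta *
      (if u ≤ p.probLoS ‖x‖ then ‖x‖ ^ (-p.alphaL) * hL else ‖x‖ ^ (-p.alphaN) * hN)

/-- The random objects from which the network is built. -/
structure Network (Ω : Type*) where
  /-- base stations, relative to the typical user -/
  bs : Ω → Measure ℂ
  /-- RISs -/
  ris : Ω → Measure RIS
  /-- mark in `[0, 1]` that decides whether the direct link is LoS -/
  mark : Ω → ℝ
  /-- angle from the user-BS link to the user-RIS link of the serving cascaded link -/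
  theta : Ω → ℝ
  /-- fading coefficient of the serving link, for each type of link -/
  fading : LinkType → Ω → ℝ
  /-- interfering users -/
  iu : Ω → Measure Interferer

namespace Network

variable {Ω : Type*} (N : Network Ω) (p : Params)

/-- Distance from the typical user to its nearest BS. -/
def tbu (ω : Ω) : ℝ := sInf {r : ℝ | 0 < N.bs ω {x | ‖x‖ ≤ r}}

/-- Distance from the typical user to its nearest RIS that provides a cascaded LoS link. -/
def tru (ω : Ω) : ℝ :=
  sInf {r : ℝ | 0 < N.ris ω {x | x ∈ eligible p (N.tbu ω) ∧ ‖x.1‖ ≤ r}}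

/-- BS-RIS distance. -/
def tbr (ω : Ω) : ℝ := Params.distBR (N.tbu ω) (N.tru p ω) (N.theta ω)

/-- The distances of the serving link. -/
def dist (ω : Ω) : Distances := (N.tbu ω, N.tru p ω, N.tbr p ω)

open Classical in
/-- Type of the serving link: direct LoS if the direct link is LoS; otherwise cascaded LoS if some
RIS provides a cascaded LoS link; otherwise direct NLoS. -/
def link (ω : Ω) : LinkType :=
  if N.mark ω ≤ p.probLoS (N.tbu ω) then .DL
  else if 0 < N.ris ω (eligible p (N.tbu ω)) then .CL
  else .DN

/-- The distances that are relevant for a link of type `q` (the others are replaced by `0`): only the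
BS-user distance for direct links, all three for a cascaded link. -/
def relDist (q : LinkType) (ω : Ω) : Distances :=
  match q with
  | .CL => N.dist p ω
  | _ => (N.tbu ω, 0, 0)

/-- Uplink interference at the tagged BS: the sum over all interfering users. -/
def interference (ω : Ω) : ℝ≥0∞ := ∫⁻ x, ENNReal.ofReal (interfPower p x) ∂(N.iu ω)

/-- Uplink SINR when the serving link has type `q` and (deterministic) distances `d`. -/
def sinrAt (q : LinkType) (d : Distances) (ω : Ω) : ℝ :=
  (ENNReal.ofReal (p.received q d (N.fading q ω)) /
    (ENNReal.ofReal p.noise + N.interference p ω)).toReal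

/-- Uplink SINR of a serving link of type `q`. -/
def sinrOf (q : LinkType) (ω : Ω) : ℝ := N.sinrAt p q (N.dist p ω) ω

/-- Uplink exposure under a serving link of type `q`. -/
def exposureOf (q : LinkType) (ω : Ω) : ℝ := p.exposure q (N.dist p ω)

/-- Uplink SINR. -/
def sinr (ω : Ω) : ℝ := N.sinrOf p (N.link p ω) ω

/-- Uplink exposure. -/
def emfe (ω : Ω) : ℝ := N.exposureOf p (N.link p ω) ω

variable [MeasurableSpace Ω] (P : Measure Ω)

/-- Joint law of the type and the distances of the serving link of the typical user. -/
def servingLaw : Measure (LinkType × Distances) :=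
  P.map (fun ω => (N.link p ω, N.dist p ω))

/-- Intensity measure of the interfering users with their marks: density `lamIU` around the tagged
BS, and independent marks; the serving link of an interfering user is distributed as the one of the
typical user. -/
def interfIntensity : Measure Interferer :=
  ((volume : Measure ℂ).withDensity (fun x => ENNReal.ofReal (p.lamIU ‖x‖))).prod
    ((N.servingLaw p P).prod ((unif 0 1).prod
      (((unif 0 (2 * Real.pi)).prod (unif 0 (2 * Real.pi))).prod
        ((fadingLaw p.mL).prod (fadingLaw p.mN)))))

/-- The σ-algebras generated by the random objects of the network. -/
@[reducible] def sources : Fin 8 → MeasurableSpace Ω :=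
  ![MeasurableSpace.comap N.bs inferInstance, MeasurableSpace.comap N.ris inferInstance,
    MeasurableSpace.comap N.mark inferInstance, MeasurableSpace.comap N.theta inferInstance,
    MeasurableSpace.comap (N.fading .DL) inferInstance,
    MeasurableSpace.comap (N.fading .CL) inferInstance,
    MeasurableSpace.comap (N.fading .DN) inferInstance,
    MeasurableSpace.comap N.iu inferInstance]

/-- The probabilistic model of the RIS-assisted network with parameters `p`. The angle of the serving
cascaded link is modelled as uniform and independent of the distances. -/
structure IsModel : Prop where
  bs_poisson : IsPoissonProcess id N.bs (ENNReal.ofReal p.lamB • volume) P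
  ris_poisson : IsPoissonProcess Prod.fst N.ris
    ((ENNReal.ofReal p.lamR • (volume : Measure ℂ)).prod
      ((unif (-Real.pi) Real.pi).prod (unif 0 1))) P
  mark_measurable : Measurable N.mark
  mark_law : P.map N.mark = unif 0 1
  theta_measurable : Measurable N.theta
  theta_law : P.map N.theta = unif (-Real.pi) Real.pi
  fading_measurable : ∀ q, Measurable (N.fading q)
  fading_law : ∀ q, P.map (N.fading q) = fadingLaw (p.shape q)
  iu_poisson : IsPoissonProcess Prod.fst N.iu (N.interfIntensity p P) P
  indep : iIndep N.sources P

/-- Conditional uplink coverage probability, given that the distances of a link of type `q`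
are `d`: the probability, over the fading and the interference, that the SINR exceeds `γ`. -/
def condCoverage (γ : ℝ) (q : LinkType) (d : Distances) : ℝ :=
  P.real {ω | γ < N.sinrAt p q d ω}

/-- Conditional uplink compliance probability, given that the distances of a link of type `q`
are `d`: the indicator that the exposure is at most `w`. -/
def condCompliance (p : Params) (w : ℝ) (q : LinkType) (d : Distances) : ℝ :=
  if p.exposure q d ≤ w then 1 else 0

/-- Conditional joint probability: coverage times compliance. -/
def condJoint (γ w : ℝ) (q : LinkType) (d : Distances) : ℝ :=
  N.condCoverage p P γ q d * condCompliance p w q d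

/-- Conditional probability of the event `s`, given the relevant distances of a link of type `q`. -/
def probGiven (q : LinkType) (s : Set Ω) : Ω → ℝ :=
  condExp (MeasurableSpace.comap (N.relDist p q) inferInstance) P (s.indicator fun _ => (1 : ℝ))

end Network

end

end RISNet

namespace RISNet

noncomputable section

/-! ## Distance to the nearest point of a point process -/

section FirstContact

variable {E : Type*} [MeasurableSpace E]

/-! The link type and the distances are functions of the base stations, the RISs, the LoS mark and
the angle; the SINR at fixed distances is a function of the fading and the interferers. These two
groups of sources are independent, so conditioning on the distances amounts to freezing them
(`condExp_indicator_of_indepFun`). Once they are frozen the exposure is deterministic, so the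
compliance event has probability 0 or 1 and the joint probability is a product (`condJoint_eq`).
This gives the three conditional identities.

For the unconditional formula, split by link type and average out the channel in the same way
(`real_link_eq`). Since `tbu` depends on the base stations alone, it can be frozen at some `x > 0`
in turn. What remains are a uniform mark, giving the factors `probLoS x` and `probNLoS x`, a uniform
angle, and the RISs eligible for this fixed `x`.

Both nearest-point distances have laws given by void probabilities: no contact up to `r` means an
empty set of points, of probability `exp (-∫ g)` if `g` is the radial intensity
(`map_firstContact`). For base stations `g` is `2πλt`. For RISs it is `lamR * (abar x t * t)`: in
polar coordinates, the orientations with both the user and the BS in front form an arc of length `π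
- arccos`, which is the content of `probReflect` (`unif_inFront`, `risIntensity_eligible`). Eligible
RISs may fail to exist, so the contact law is a sub-probability of mass `probCL x`; this mass
cancels the denominator of `pdfRU` (`assoc_CL_mul_pdfRU`).

The delicate technical point is measurability: freezing `x` needs the mass of `eligible p x` to be
jointly measurable in `x` and the RIS configuration. This is obtained from an s-finite kernel on
locally finite measures. -/

/-- The distance from the origin to the nearest point of `m` that lies in `S`. -/
def firstContact (pos : E → ℂ) (m : Measure E) (S : Set E) : ℝ :=
  sInf {r : ℝ | 0 < m {x | x ∈ S ∧ ‖pos x‖ ≤ r}}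

variable {pos : E → ℂ} {m : Measure E} {S : Set E}

lemma measure_section_mono (pos : E → ℂ) (m : Measure E) (S : Set E) {r s : ℝ} (h : r ≤ s) :
    m {x | x ∈ S ∧ ‖pos x‖ ≤ r} ≤ m {x | x ∈ S ∧ ‖pos x‖ ≤ s} :=
  measure_mono fun _ hx => ⟨hx.1, hx.2.trans h⟩

lemma nonneg_of_measure_section_pos {r : ℝ} (h : 0 < m {x | x ∈ S ∧ ‖pos x‖ ≤ r}) : 0 ≤ r := by
  by_contra hr
  have : {x | x ∈ S ∧ ‖pos x‖ ≤ r} = ∅ := by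
    ext x
    simp only [Set.mem_ofPred_eq, Set.mem_empty_iff_false, iff_false, not_and]
    intro _ h'
    exact hr ((norm_nonneg _).trans h')
  simp [this] at h

lemma bddBelow_measure_section (pos : E → ℂ) (m : Measure E) (S : Set E) :
    BddBelow {r : ℝ | 0 < m {x | x ∈ S ∧ ‖pos x‖ ≤ r}} :=
  ⟨0, fun _ hr => nonneg_of_measure_section_pos hr⟩

lemma exists_measure_section_pos (pos : E → ℂ) (h : 0 < m S) :
    ∃ n : ℕ, 0 < m {x | x ∈ S ∧ ‖pos x‖ ≤ n} := by
  by_contra! H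
  have hU : S = ⋃ n : ℕ, {x | x ∈ S ∧ ‖pos x‖ ≤ n} := by
    ext x
    simp only [Set.mem_iUnion, Set.mem_ofPred_eq, exists_and_left]
    exact ⟨fun hx => ⟨hx, exists_nat_ge _⟩, fun hx => hx.1⟩
  rw [hU, measure_iUnion_null fun n => le_antisymm (H n) bot_le] at h
  exact lt_irrefl _ h

/-- The infimum is attained: local finiteness gives continuity from above in the radius, and an
integer-valued mass that tends to 0 is eventually 0, which leaves an empty margin beyond `r`. The
assumption `0 < m S` excludes the infimum of the empty set, whose default value is 0. -/
lemma firstContact_le_iff (hpos : Measurable pos) (hS : MeasurableSet S)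
    (hint : ∀ B, MeasurableSet B → ∃ n : ℕ∞, m B = (n : ℝ≥0∞))
    (hfin : ∀ R : ℝ, m {x | ‖pos x‖ ≤ R} < ∞) (h : 0 < m S) (r : ℝ) :
    firstContact pos m S ≤ r ↔ 0 < m {x | x ∈ S ∧ ‖pos x‖ ≤ r} := by
  have hmeas : ∀ s : ℝ, MeasurableSet {x | x ∈ S ∧ ‖pos x‖ ≤ s} := fun s =>
    hS.inter (measurableSet_le hpos.norm measurable_const)
  refine ⟨fun hle => ?_, fun hr => csInf_le (bddBelow_measure_section pos m S) hr⟩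
  by_contra hr
  replace hr : m {x | x ∈ S ∧ ‖pos x‖ ≤ r} = 0 := by simpa using hr
  have hlim : Filter.Tendsto (fun n : ℕ => m {x | x ∈ S ∧ ‖pos x‖ ≤ r + 1 / ((n : ℝ) + 1)})
      Filter.atTop (nhds (m (⋂ n : ℕ, {x | x ∈ S ∧ ‖pos x‖ ≤ r + 1 / ((n : ℝ) + 1)}))) := by
    refine tendsto_measure_iInter_atTop (fun n => (hmeas _).nullMeasurableSet) ?_ ⟨0, ?_⟩
    · intro i j hij x hx
      refine ⟨hx.1, hx.2.trans ?_⟩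
      have := Nat.one_div_le_one_div (α := ℝ) hij
      linarith
    · exact ((measure_mono fun x hx => hx.2).trans_lt (hfin _)).ne
  have hI : (⋂ n : ℕ, {x | x ∈ S ∧ ‖pos x‖ ≤ r + 1 / ((n : ℝ) + 1)}) =
      {x | x ∈ S ∧ ‖pos x‖ ≤ r} := by
    ext x
    simp only [Set.mem_iInter, Set.mem_ofPred_eq]
    refine ⟨fun hx => ⟨(hx 0).1, ?_⟩, fun hx n => ⟨hx.1, hx.2.trans ?_⟩⟩
    · have h1 : Filter.Tendsto (fun n : ℕ => r + 1 / ((n : ℝ) + 1)) Filter.atTop (nhds (r + 0)) :=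
        tendsto_const_nhds.add tendsto_one_div_add_atTop_nhds_zero_nat
      rw [add_zero] at h1
      exact ge_of_tendsto' h1 fun n => (hx n).2
    · have : (0 : ℝ) < 1 / ((n : ℝ) + 1) := by positivity
      linarith
  rw [hI, hr] at hlim
  -- A mass below one is an integer below one, hence zero.
  obtain ⟨n, hn⟩ := (hlim.eventually (gt_mem_nhds one_pos)).exists
  have h0 : m {x | x ∈ S ∧ ‖pos x‖ ≤ r + 1 / ((n : ℝ) + 1)} = 0 := by
    obtain ⟨k, hk⟩ := hint _ (hmeas (r + 1 / ((n : ℝ) + 1)))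
    rw [hk] at hn ⊢
    have : k < 1 := by exact_mod_cast hn
    have : k = 0 := by simpa [Order.lt_one_iff] using this
    simp [this]
  have hge : r + 1 / ((n : ℝ) + 1) ≤ firstContact pos m S := by
    obtain ⟨k, hk⟩ := exists_measure_section_pos pos h
    refine le_csInf ⟨k, hk⟩ fun s hs => ?_
    by_contra! hlt
    have h1 := measure_section_mono pos m S hlt.le
    rw [h0] at h1
    exact absurd hs (not_lt.2 h1)
  have : (0 : ℝ) < 1 / ((n : ℝ) + 1) := by positivity
  linarith

lemma measurable_firstContact {α : Type*} [MeasurableSpace α] {m : α → Measure E} {S : α → Set E}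
    (h : ∀ r : ℝ, Measurable fun y => m y {x | x ∈ S y ∧ ‖pos x‖ ≤ r}) :
    Measurable fun y => firstContact pos (m y) (S y) := by
  refine measurable_of_Iio fun c => ?_
  -- Monotonicity in the radius reduces the union to rational radii. The second set collects the
  -- configurations without points in `S y`, where `sInf ∅ = 0`.
  have : (fun y => firstContact pos (m y) (S y)) ⁻¹' Set.Iio c =
      (⋃ q : ℚ, {y | (q : ℝ) < c ∧ 0 < m y {x | x ∈ S y ∧ ‖pos x‖ ≤ q}}) ∪
        {y | (∀ n : ℕ, m y {x | x ∈ S y ∧ ‖pos x‖ ≤ n} = 0) ∧ 0 < c} := by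
    ext y
    simp only [Set.mem_preimage, Set.mem_Iio, Set.mem_union, Set.mem_iUnion, Set.mem_ofPred_eq]
    by_cases hne : {r : ℝ | 0 < m y {x | x ∈ S y ∧ ‖pos x‖ ≤ r}}.Nonempty
    · rw [firstContact, csInf_lt_iff (bddBelow_measure_section _ _ _) hne]
      constructor
      · rintro ⟨s, hs, hsc⟩
        obtain ⟨q, hq1, hq2⟩ := exists_rat_btwn hsc
        exact Or.inl ⟨q, hq2, lt_of_lt_of_le hs (measure_section_mono _ _ _ hq1.le)⟩
      · rintro (⟨q, hq, hq'⟩ | ⟨h0, -⟩)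
        · exact ⟨q, hq', hq⟩
        · obtain ⟨s, hs⟩ := hne
          obtain ⟨n, hn⟩ := exists_nat_ge s
          have := measure_section_mono pos (m y) (S y) hn
          rw [h0 n] at this
          exact absurd hs (not_lt.2 this)
    · have he := Set.not_nonempty_iff_eq_empty.1 hne
      rw [firstContact, he, Real.sInf_empty]
      have h0 : ∀ r : ℝ, m y {x | x ∈ S y ∧ ‖pos x‖ ≤ r} = 0 := by
        intro r
        by_contra hr
        exact hne ⟨r, pos_iff_ne_zero.2 hr⟩
      simp [h0]
  rw [this]
  refine MeasurableSet.union (MeasurableSet.iUnion fun q => ?_) ?_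
  · exact (MeasurableSet.const _).inter (measurableSet_lt measurable_const (h q))
  · have h0 : MeasurableSet {y | ∀ n : ℕ, m y {x | x ∈ S y ∧ ‖pos x‖ ≤ n} = 0} := by
      rw [Set.ofPred_forall]
      exact MeasurableSet.iInter fun n => h n (measurableSet_singleton 0)
    exact h0.inter (.const _)

end FirstContact

/-! ## Measurability in a locally finite measure -/

section LocallyFinite

variable {α E : Type*} [MeasurableSpace α] [MeasurableSpace E]

/-- The total masses are finite but need not be uniformly bounded; cutting the parameter space by
the integer part of the mass gives countably many bounded pieces. -/
lemma isSFiniteKernel_of_finite (κ : Kernel α E) (h : ∀ y, κ y Set.univ < ∞) :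
    IsSFiniteKernel κ := by
  classical
  have hm : ∀ k : ℕ, MeasurableSet {y | ⌊(κ y Set.univ).toNNReal⌋₊ = k} := fun k =>
    (Nat.measurable_floor.comp (κ.measurable_coe .univ).ennreal_toNNReal)
      (measurableSet_singleton k)
  have hsum : κ = Kernel.sum fun k => Kernel.piecewise (hm k) κ 0 := by
    ext y s hs
    rw [Kernel.sum_apply' _ _ hs, tsum_eq_single ⌊(κ y Set.univ).toNNReal⌋₊]
    · simp [Kernel.piecewise_apply]
    · intro k hk
      simp [Kernel.piecewise_apply, hk.symm]
  have hfin : ∀ k, IsFiniteKernel (Kernel.piecewise (hm k) κ 0) := by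
    refine fun k => ⟨(k : ℝ≥0∞) + 1, by simp, fun y => ?_⟩
    rw [Kernel.piecewise_apply]
    split_ifs with hy
    · have h1 := (Nat.lt_floor_add_one (κ y Set.univ).toNNReal).le
      have hy' : ⌊(κ y Set.univ).toNNReal⌋₊ = k := hy
      rw [hy'] at h1
      rw [← ENNReal.coe_toNNReal (h y).ne]
      exact_mod_cast h1
    · simp
  rw [hsum]
  infer_instance

/-- The measures that are finite on the points with position in a bounded set. -/
def locallyFinite (pos : E → ℂ) : Set (Measure E) := {m | ∀ n : ℕ, m {x | ‖pos x‖ ≤ n} < ∞}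

lemma measurableSet_locallyFinite {pos : E → ℂ} (hpos : Measurable pos) :
    MeasurableSet (locallyFinite pos) := by
  rw [locallyFinite, Set.ofPred_forall]
  exact MeasurableSet.iInter fun _ => measurableSet_lt
    (Measure.measurable_coe (measurableSet_le hpos.norm measurable_const)) measurable_const

open Classical in
/-- The kernel that maps a locally finite measure to itself, and any other measure to `0`. -/
def locallyFiniteKernel {pos : E → ℂ} (hpos : Measurable pos) : Kernel (Measure E) E :=
  Kernel.piecewise (measurableSet_locallyFinite hpos) ⟨id, measurable_id⟩ 0

lemma locallyFiniteKernel_apply {pos : E → ℂ} (hpos : Measurable pos) {m : Measure E}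
    (hm : m ∈ locallyFinite pos) : locallyFiniteKernel hpos m = m := by
  classical
  rw [locallyFiniteKernel, Kernel.piecewise_apply, if_pos hm]
  rfl

lemma locallyFiniteKernel_lt_top {pos : E → ℂ} (hpos : Measurable pos) (m : Measure E) (n : ℕ) :
    locallyFiniteKernel hpos m {x | ‖pos x‖ ≤ n} < ∞ := by
  classical
  rw [locallyFiniteKernel, Kernel.piecewise_apply]
  split_ifs with h
  · exact h n
  · simp

/-- Cutting `E` into annuli by the integer part of `‖pos x‖` leaves kernels with finite masses, to
which `isSFiniteKernel_of_finite` applies. -/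
instance isSFiniteKernel_locallyFiniteKernel {pos : E → ℂ} (hpos : Measurable pos) :
    IsSFiniteKernel (locallyFiniteKernel hpos) := by
  have hm : ∀ n : ℕ, MeasurableSet {x | ⌊‖pos x‖⌋₊ = n} := fun n =>
    (Nat.measurable_floor.comp hpos.norm) (measurableSet_singleton n)
  have hsum : locallyFiniteKernel hpos =
      Kernel.sum fun n => (locallyFiniteKernel hpos).restrict (hm n) := by
    ext m s hs
    rw [Kernel.sum_apply' _ _ hs]
    simp only [Kernel.restrict_apply' _ _ _ hs]
    rw [← measure_iUnion]
    · congr 1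
      ext x
      simp
    · intro i j hij
      refine Set.disjoint_left.2 fun x hx hx' => hij ?_
      exact hx.2.symm.trans hx'.2
    · exact fun n => hs.inter (hm n)
  have : ∀ n, IsSFiniteKernel ((locallyFiniteKernel hpos).restrict (hm n)) := by
    refine fun n => isSFiniteKernel_of_finite _ fun m => ?_
    rw [Kernel.restrict_apply' _ _ _ .univ, Set.univ_inter]
    refine (measure_mono fun x hx => ?_).trans_lt (locallyFiniteKernel_lt_top hpos m (n + 1))
    have h1 := (Nat.lt_floor_add_one ‖pos x‖).le
    have hx' : ⌊‖pos x‖⌋₊ = n := hx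
    rw [hx'] at h1
    simpa using h1
  rw [hsum]
  infer_instance

/-- Evaluation on a fixed set is measurable by definition of the σ-algebra on measures. Here the set
moves with a parameter, and s-finiteness of the kernel is what gives joint measurability. -/
lemma measurable_locallyFiniteKernel_section {pos : E → ℂ} (hpos : Measurable pos)
    {A : α → Set E} (hA : MeasurableSet {z : α × E | z.2 ∈ A z.1}) :
    Measurable fun y : α × Measure E => locallyFiniteKernel hpos y.2 (A y.1) := by
  have h := Kernel.measurable_kernel_prodMk_left
    (κ := (locallyFiniteKernel hpos).comap (Prod.snd : α × Measure E → Measure E) measurable_snd)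
    (t := {z : (α × Measure E) × E | z.2 ∈ A z.1.1})
    ((measurable_fst.fst.prodMk measurable_snd) hA)
  exact h

end LocallyFinite

/-! ## Void probabilities and contact distances of Poisson processes -/

section Contact

variable {Ω E : Type*} [MeasurableSpace Ω] [MeasurableSpace E] {pos : E → ℂ} {Ψ : Ω → Measure E}
  {Λ : Measure E} {P : Measure Ω}

lemma IsPoissonProcess.measurable_apply (h : IsPoissonProcess pos Ψ Λ P) {B : Set E}
    (hB : MeasurableSet B) : Measurable fun ω => Ψ ω B :=
  (Measure.measurable_coe hB).comp h.measurable

lemma IsPoissonProcess.measure_void (h : IsPoissonProcess pos Ψ Λ P) {B : Set E}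
    (hB : MeasurableSet B) (hΛ : Λ B < ∞) :
    P {ω | Ψ ω B = 0} = ENNReal.ofReal (Real.exp (-(Λ B).toReal)) := by
  have h1 := congrArg (fun μ : Measure ℝ≥0∞ => μ {0}) (h.poisson B hB hΛ)
  rw [Measure.map_apply (h.measurable_apply hB) (measurableSet_singleton 0),
    Measure.map_apply (by fun_prop) (measurableSet_singleton 0)] at h1
  have h2 : (fun n : ℕ => (n : ℝ≥0∞)) ⁻¹' {0} = {0} := by
    ext n
    simp
  rw [h2, poissonMeasure_singleton] at h1
  simp only [pow_zero, mul_one, Nat.factorial_zero, Nat.cast_one, div_one] at h1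
  exact h1

lemma IsPoissonProcess.mem_locallyFinite (h : IsPoissonProcess pos Ψ Λ P) (ω : Ω) :
    Ψ ω ∈ locallyFinite pos :=
  fun n => h.locally_finite ω n

lemma IsPoissonProcess.measurable_firstContact (h : IsPoissonProcess pos Ψ Λ P)
    (hpos : Measurable pos) {S : Set E} (hS : MeasurableSet S) :
    Measurable fun ω => firstContact pos (Ψ ω) S :=
  RISNet.measurable_firstContact fun _ =>
    h.measurable_apply (hS.inter (measurableSet_le hpos.norm measurable_const))

/-- The integrand is the derivative of `-exp (-∫ g)`. This turns a void probability into a density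
of the contact distance. -/
lemma integral_mul_exp_neg_integral {g : ℝ → ℝ} (hg : Continuous g) (r : ℝ) :
    ∫ y in (0 : ℝ)..r, g y * Real.exp (-∫ t in (0 : ℝ)..y, g t) =
      1 - Real.exp (-∫ t in (0 : ℝ)..r, g t) := by
  have hG : ∀ y, HasDerivAt (fun y => ∫ t in (0 : ℝ)..y, g t) (g y) y := fun y =>
    (hg.integral_hasStrictDerivAt 0 y).hasDerivAt
  have hd : ∀ y, HasDerivAt (fun y => -Real.exp (-∫ t in (0 : ℝ)..y, g t))
      (g y * Real.exp (-∫ t in (0 : ℝ)..y, g t)) y := fun y => by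
    refine ((hG y).neg.exp).neg.congr_deriv ?_
    simp only [Pi.neg_apply]
    ring
  have hc : Continuous fun y => g y * Real.exp (-∫ t in (0 : ℝ)..y, g t) :=
    hg.mul (Real.continuous_exp.comp (continuous_iff_continuousAt.2 fun y =>
      (hG y).continuousAt).neg)
  rw [intervalIntegral.integral_eq_sub_of_hasDerivAt (fun y _ => hd y) (hc.intervalIntegrable _ _)]
  simp
  ring

lemma continuous_mul_exp_neg_integral {g : ℝ → ℝ} (hg : Continuous g) :
    Continuous fun y => g y * Real.exp (-∫ t in (0 : ℝ)..y, g t) :=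
  hg.mul (Real.continuous_exp.comp (continuous_iff_continuousAt.2 fun y =>
      ((hg.integral_hasStrictDerivAt 0 y).hasDerivAt).continuousAt).neg)

/-- Compare the masses of half-lines: contact within `r` is the complement of a void event. The
restriction to `0 < Ψ ω S` is needed because an empty configuration would otherwise put an atom at
the default value 0. -/
lemma IsPoissonProcess.map_firstContact [IsProbabilityMeasure P] (h : IsPoissonProcess pos Ψ Λ P)
    (hpos : Measurable pos) {S : Set E} (hS : MeasurableSet S) {g : ℝ → ℝ} (hg : Continuous g)
    (hg0 : ∀ t, 0 ≤ t → 0 ≤ g t)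
    (hΛ : ∀ r, 0 ≤ r → Λ {x | x ∈ S ∧ ‖pos x‖ ≤ r} = ENNReal.ofReal (∫ t in (0 : ℝ)..r, g t)) :
    (P.restrict {ω | 0 < Ψ ω S}).map (fun ω => firstContact pos (Ψ ω) S) =
      (volume.restrict (Set.Ioi 0)).withDensity
        fun y => ENNReal.ofReal (g y * Real.exp (-∫ t in (0 : ℝ)..y, g t)) := by
  have hT := h.measurable_firstContact hpos hS
  have hset : ∀ r : ℝ, MeasurableSet {x | x ∈ S ∧ ‖pos x‖ ≤ r} := fun r =>
    hS.inter (measurableSet_le hpos.norm measurable_const)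
  refine Measure.ext_of_Iic _ _ fun r => ?_
  rw [Measure.map_apply hT measurableSet_Iic, Measure.restrict_apply (hT measurableSet_Iic),
    withDensity_apply _ measurableSet_Iic, Measure.restrict_restrict measurableSet_Iic]
  have h1 : (fun ω => firstContact pos (Ψ ω) S) ⁻¹' Set.Iic r ∩ {ω | 0 < Ψ ω S} =
      {ω | Ψ ω {x | x ∈ S ∧ ‖pos x‖ ≤ r} = 0}ᶜ := by
    ext ω
    simp only [Set.mem_inter_iff, Set.mem_preimage, Set.mem_Iic, Set.mem_ofPred_eq,
      Set.mem_compl_iff, ← pos_iff_ne_zero]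
    constructor
    · rintro ⟨h1, h2⟩
      exact (firstContact_le_iff hpos hS (h.integer_valued ω) (h.locally_finite ω) h2 r).1 h1
    · intro h1
      have h2 : 0 < Ψ ω S := h1.trans_le (measure_mono fun x hx => hx.1)
      exact ⟨(firstContact_le_iff hpos hS (h.integer_valued ω) (h.locally_finite ω) h2 r).2 h1, h2⟩
  rw [h1]
  rcases lt_or_ge r 0 with hr | hr
  · have h2 : {x | x ∈ S ∧ ‖pos x‖ ≤ r} = ∅ := by
      ext x
      simp only [Set.mem_ofPred_eq, Set.mem_empty_iff_false, iff_false, not_and, not_le]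
      exact fun _ => hr.trans_le (norm_nonneg _)
    have h3 : Set.Iic r ∩ Set.Ioi 0 = ∅ := by
      ext y
      simp only [Set.mem_inter_iff, Set.mem_Iic, Set.mem_Ioi, Set.mem_empty_iff_false, iff_false]
      intro h
      linarith [h.1, h.2]
    simp [h2, h3]
  · have hG0 : 0 ≤ ∫ t in (0 : ℝ)..r, g t :=
      intervalIntegral.integral_nonneg hr fun t ht => hg0 t ht.1
    have h3 : Set.Iic r ∩ Set.Ioi 0 = Set.Ioc 0 r := by
      rw [Set.inter_comm]
      exact Set.Ioi_inter_Iic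
    have hm0 : MeasurableSet {ω | Ψ ω {x | x ∈ S ∧ ‖pos x‖ ≤ r} = 0} :=
      h.measurable_apply (hset r) (measurableSet_singleton 0)
    rw [prob_compl_eq_one_sub hm0,
      h.measure_void (hset r) (by rw [hΛ r hr]; simp), hΛ r hr, ENNReal.toReal_ofReal hG0, h3,
      ← ofReal_integral_eq_lintegral_ofReal, ← intervalIntegral.integral_of_le hr,
      integral_mul_exp_neg_integral hg, ENNReal.ofReal_sub _ (Real.exp_nonneg _),
      ENNReal.ofReal_one]
    · exact (continuous_mul_exp_neg_integral hg).integrableOn_Ioc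
    · filter_upwards [ae_restrict_mem measurableSet_Ioc] with y hy
      exact mul_nonneg (hg0 y hy.1.le) (Real.exp_nonneg _)

/-- Expectations of functions of the contact distance, on the event that there is a point. -/
lemma IsPoissonProcess.setIntegral_firstContact [IsProbabilityMeasure P]
    (h : IsPoissonProcess pos Ψ Λ P)
    (hpos : Measurable pos) {S : Set E} (hS : MeasurableSet S) {g : ℝ → ℝ} (hg : Continuous g)
    (hg0 : ∀ t, 0 ≤ t → 0 ≤ g t)
    (hΛ : ∀ r, 0 ≤ r → Λ {x | x ∈ S ∧ ‖pos x‖ ≤ r} = ENNReal.ofReal (∫ t in (0 : ℝ)..r, g t))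
    {f : ℝ → ℝ} (hf : Measurable f) :
    ∫ ω in {ω | 0 < Ψ ω S}, f (firstContact pos (Ψ ω) S) ∂P =
      ∫ y in Set.Ioi (0 : ℝ), f y * (g y * Real.exp (-∫ t in (0 : ℝ)..y, g t)) := by
  rw [← integral_map (h.measurable_firstContact hpos hS).aemeasurable
    hf.aestronglyMeasurable, h.map_firstContact hpos hS hg hg0 hΛ,
    integral_withDensity_eq_integral_toReal_smul
      (continuous_mul_exp_neg_integral hg).measurable.ennreal_ofReal (by simp)]
  refine setIntegral_congr_fun measurableSet_Ioi fun y hy => ?_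
  rw [ENNReal.toReal_ofReal (mul_nonneg (hg0 y (le_of_lt hy)) (Real.exp_nonneg _)), smul_eq_mul,
    mul_comm]

end Contact

/-! ## Independent random variables -/

section Independence

variable {Ω α β : Type*} [MeasurableSpace Ω] [MeasurableSpace α] [MeasurableSpace β]
  {P : Measure Ω} [IsProbabilityMeasure P] {X : Ω → α} {Y : Ω → β}

lemma integrable_comp_prod_of_bounded {h : α × β → ℝ} (hX : Measurable X) (hY : Measurable Y)
    (hh : Measurable h) {C : ℝ} (hC : ∀ z, |h z| ≤ C) :
    Integrable h ((P.map X).prod (P.map Y)) := by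
  have := Measure.isProbabilityMeasure_map (μ := P) hX.aemeasurable
  have := Measure.isProbabilityMeasure_map (μ := P) hY.aemeasurable
  exact Integrable.of_bound hh.aestronglyMeasurable C (.of_forall hC)

/-- Fubini for the product law of `X` and `Y`; the bound on `h` supplies integrability. -/
lemma integral_indepFun (hXY : IndepFun X Y P) (hX : Measurable X) (hY : Measurable Y)
    {h : α × β → ℝ} (hh : Measurable h) {C : ℝ} (hC : ∀ z, |h z| ≤ C) :
    ∫ ω, h (X ω, Y ω) ∂P = ∫ x, ∫ ω, h (x, Y ω) ∂P ∂(P.map X) := by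
  have := Measure.isProbabilityMeasure_map (μ := P) hX.aemeasurable
  have := Measure.isProbabilityMeasure_map (μ := P) hY.aemeasurable
  rw [← integral_map (f := h) (hX.prodMk hY).aemeasurable hh.aestronglyMeasurable,
    (indepFun_iff_map_prod_eq_prod_map_map hX.aemeasurable hY.aemeasurable).1 hXY,
    integral_prod _ (integrable_comp_prod_of_bounded hX hY hh hC)]
  refine integral_congr_ae (.of_forall fun x => ?_)
  exact integral_map hY.aemeasurable (hh.comp measurable_prodMk_left).aestronglyMeasurable

lemma integrable_integral_indepFun (hX : Measurable X) (hY : Measurable Y)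
    {h : α × β → ℝ} (hh : Measurable h) {C : ℝ} (hC : ∀ z, |h z| ≤ C) :
    Integrable (fun x => ∫ ω, h (x, Y ω) ∂P) (P.map X) := by
  have := Measure.isProbabilityMeasure_map (μ := P) hX.aemeasurable
  have := Measure.isProbabilityMeasure_map (μ := P) hY.aemeasurable
  refine (integrable_comp_prod_of_bounded hX hY hh hC).integral_prod_left.congr
    (.of_forall fun x => ?_)
  exact integral_map hY.aemeasurable (hh.comp measurable_prodMk_left).aestronglyMeasurable

lemma measurable_integral_section (hY : Measurable Y) {h : α × β → ℝ}
    (hh : Measurable h) : Measurable fun x => ∫ ω, h (x, Y ω) ∂P :=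
  (hh.comp (measurable_fst.prodMk (hY.comp measurable_snd))).stronglyMeasurable.integral_prod_right'
    (ν := P) |>.measurable

lemma measurable_real_section (hY : Measurable Y) {A : Set (α × β)} (hA : MeasurableSet A) :
    Measurable fun x => P.real {ω | (x, Y ω) ∈ A} := by
  have := Measure.isProbabilityMeasure_map (μ := P) hY.aemeasurable
  have h := (measurable_measure_prodMk_left (ν := P.map Y) hA).ennreal_toReal
  convert h using 2 with x
  rw [Measure.real, Measure.map_apply hY (measurable_prodMk_left hA)]
  rfl

/-- Averaging over `Y` in an event that depends on the independent variables `X` and `Y`. -/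
lemma setIntegral_real_section (hXY : IndepFun X Y P) (hX : Measurable X) (hY : Measurable Y)
    {A : Set (α × β)} (hA : MeasurableSet A) {s : Set α} (hs : MeasurableSet s) :
    P.real {ω | X ω ∈ s ∧ (X ω, Y ω) ∈ A} =
      ∫ ω in X ⁻¹' s, P.real {ω' | (X ω, Y ω') ∈ A} ∂P := by
  set B : Set (α × β) := Prod.fst ⁻¹' s ∩ A with hB
  have hBm : MeasurableSet B := (measurable_fst hs).inter hA
  have h1 := integral_indepFun hXY hX hY (h := B.indicator fun _ => (1 : ℝ))
    (measurable_const.indicator hBm) (C := 1) (fun z => by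
      by_cases hz : z ∈ B <;> simp [hz])
  have h2 : ∀ ω, B.indicator (fun _ => (1 : ℝ)) (X ω, Y ω) =
      {ω | X ω ∈ s ∧ (X ω, Y ω) ∈ A}.indicator 1 ω := fun ω => rfl
  have hm : MeasurableSet {ω | X ω ∈ s ∧ (X ω, Y ω) ∈ A} := (hX.prodMk hY) hBm
  simp only [h2] at h1
  rw [integral_indicator_one hm] at h1
  have h3 : ∀ x, ∫ ω, B.indicator (fun _ => (1 : ℝ)) (x, Y ω) ∂P =
      s.indicator (fun x => P.real {ω | (x, Y ω) ∈ A}) x := by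
    intro x
    by_cases hx : x ∈ s
    · have hAx : MeasurableSet {ω | (x, Y ω) ∈ A} := (measurable_prodMk_left.comp hY) hA
      rw [Set.indicator_of_mem hx, ← integral_indicator_one hAx]
      refine integral_congr_ae (.of_forall fun ω => ?_)
      by_cases hz : (x, Y ω) ∈ A
      · simp [Set.indicator, hB, hx, hz]
      · simp [Set.indicator, hB, hx, hz]
    · rw [Set.indicator_of_notMem hx]
      refine integral_eq_zero_of_ae (.of_forall fun ω => ?_)
      simp [Set.indicator, hB, hx]
  simp only [h3] at h1
  rw [h1, integral_indicator hs, setIntegral_map hs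
    (measurable_real_section hY hA).aestronglyMeasurable hX.aemeasurable]

/-- Freezing of `X`: by independence the section probability has the right integral over every event
`X ⁻¹' s`, and it is measurable with respect to `X`, which characterises the conditional
expectation. -/
lemma condExp_indicator_of_indepFun (hXY : IndepFun X Y P) (hX : Measurable X) (hY : Measurable Y)
    {A : Set (α × β)} (hA : MeasurableSet A) :
    condExp (MeasurableSpace.comap X inferInstance) P
        ({ω | (X ω, Y ω) ∈ A}.indicator fun _ => (1 : ℝ)) =ᵐ[P]
      fun ω => P.real {ω' | (X ω, Y ω') ∈ A} := by
  have hm : MeasurableSet {ω | (X ω, Y ω) ∈ A} := (hX.prodMk hY) hA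
  have hr := measurable_real_section (P := P) hY hA
  refine (ae_eq_condExp_of_forall_setIntegral_eq hX.comap_le
    ((integrable_const (1 : ℝ)).indicator hm) ?_ ?_ ?_).symm
  · intro s _ _
    refine Integrable.integrableOn (Integrable.of_bound (hr.comp hX).aestronglyMeasurable 1
      (.of_forall fun ω => ?_))
    rw [Real.norm_of_nonneg measureReal_nonneg]
    exact measureReal_le_one
  · rintro _ ⟨s, hs, rfl⟩ _
    rw [← setIntegral_real_section hXY hX hY hA hs, setIntegral_indicator hm, setIntegral_const]
    simp only [smul_eq_mul, mul_one]
    rfl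
  · exact (hr.comp (comap_measurable X)).aestronglyMeasurable

end Independence

/-! ## The probability that a RIS has the user and the BS on its front side -/

section Reflection

/-- Two open half-circles of directions whose axes differ by an angle `c` intersect in one arc, of
length `π - c`. -/
lemma cos_pos_and_cos_sub_pos_iff {c ψ : ℝ} (hc0 : 0 ≤ c) (hcπ : c ≤ Real.pi)
    (hψ : ψ ∈ Set.Ioc (-Real.pi) Real.pi) :
    (0 < Real.cos ψ ∧ 0 < Real.cos (ψ - c)) ↔ ψ ∈ Set.Ioo (c - Real.pi / 2) (Real.pi / 2) := by
  have hπ := Real.pi_pos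
  constructor
  · rintro ⟨h1, h2⟩
    have h3 : ψ < Real.pi / 2 := by
      by_contra! h
      exact absurd h1 (not_lt.2 (Real.cos_nonpos_of_pi_div_two_le_of_le h (by linarith [hψ.2])))
    have h4 : -(Real.pi / 2) < ψ := by
      by_contra! h
      rw [← Real.cos_neg] at h1
      exact absurd h1 (not_lt.2
        (Real.cos_nonpos_of_pi_div_two_le_of_le (by linarith) (by linarith [hψ.1])))
    refine ⟨?_, h3⟩
    by_contra! h
    rw [← Real.cos_neg] at h2
    exact absurd h2 (not_lt.2
      (Real.cos_nonpos_of_pi_div_two_le_of_le (by linarith) (by linarith)))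
  · rintro ⟨h1, h2⟩
    exact ⟨Real.cos_pos_of_mem_Ioo ⟨by linarith, h2⟩,
      Real.cos_pos_of_mem_Ioo ⟨by linarith, by linarith⟩⟩

/-- The indicator of the directions that have positive inner product with `(1, 0)` and `(A, B)`. -/
def frontIndicator (A B ψ : ℝ) : ℝ :=
  {ψ : ℝ | 0 < Real.cos ψ ∧ 0 < A * Real.cos ψ + B * Real.sin ψ}.indicator (fun _ => 1) ψ

lemma frontIndicator_neg (A B ψ : ℝ) : frontIndicator A B (-ψ) = frontIndicator A (-B) ψ := by
  simp [frontIndicator, Set.indicator]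

lemma frontIndicator_periodic (A B : ℝ) :
    Function.Periodic (frontIndicator A B) (2 * Real.pi) := fun ψ => by
  simp [frontIndicator, Set.indicator]

/-- Write `(A, B) = D (cos c, sin c)` with `c = arccos (A / D)`; the sign of `B` makes the sine
correct, as `c` lies in `[0, π]`. The indicator is then that of an arc of length `π - c`. -/
lemma integral_frontIndicator_of_nonneg {A B D : ℝ} (hD : 0 < D) (h : A ^ 2 + B ^ 2 = D ^ 2)
    (hB : 0 ≤ B) :
    ∫ ψ in (-Real.pi)..Real.pi, frontIndicator A B ψ = Real.pi - Real.arccos (A / D) := by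
  have hπ := Real.pi_pos
  set c := Real.arccos (A / D) with hc
  have hc0 : 0 ≤ c := Real.arccos_nonneg _
  have hcπ : c ≤ Real.pi := Real.arccos_le_pi _
  have hAD : |A| ≤ D := abs_le_of_sq_le_sq (by nlinarith [sq_nonneg B]) hD.le
  obtain ⟨hA1, hA2⟩ := abs_le.1 hAD
  have hcos : A = D * Real.cos c := by
    rw [hc, Real.cos_arccos (by rw [le_div_iff₀ hD]; linarith) (by rw [div_le_iff₀ hD]; linarith)]
    field_simp
  have hsin : B = D * Real.sin c := by
    rw [hc, Real.sin_arccos]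
    have : 1 - (A / D) ^ 2 = (B / D) ^ 2 := by
      field_simp
      linarith
    rw [this, Real.sqrt_sq (by positivity)]
    field_simp
  have hset : Set.EqOn (frontIndicator A B)
      ((Set.Ioo (c - Real.pi / 2) (Real.pi / 2)).indicator fun _ => 1)
      (Set.Ioc (-Real.pi) Real.pi) := by
    intro ψ hψ
    have hiff := cos_pos_and_cos_sub_pos_iff hc0 hcπ hψ
    have h2 : A * Real.cos ψ + B * Real.sin ψ = D * Real.cos (ψ - c) := by
      rw [Real.cos_sub]
      nth_rewrite 1 [hcos]
      nth_rewrite 1 [hsin]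
      ring
    have h3 : (0 < Real.cos ψ ∧ 0 < A * Real.cos ψ + B * Real.sin ψ) ↔
        ψ ∈ Set.Ioo (c - Real.pi / 2) (Real.pi / 2) := by
      rw [h2, mul_pos_iff_of_pos_left hD, hiff]
    simp only [frontIndicator, Set.indicator, Set.mem_ofPred_eq, h3]
  have hsub : Set.Ioo (c - Real.pi / 2) (Real.pi / 2) ⊆ Set.Ioc (-Real.pi) Real.pi :=
    fun ψ hψ => ⟨by linarith [hψ.1], by linarith [hψ.2]⟩
  rw [intervalIntegral.integral_of_le (by linarith), setIntegral_congr_fun measurableSet_Ioc hset,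
    setIntegral_indicator measurableSet_Ioo, Set.inter_eq_right.2 hsub, setIntegral_const,
    Real.volume_real_Ioo, max_eq_left (by linarith)]
  simp
  ring

/-- The reflection `ψ ↦ -ψ` changes the sign of `B` and preserves the integral. -/
lemma integral_frontIndicator {A B D : ℝ} (hD : 0 < D) (h : A ^ 2 + B ^ 2 = D ^ 2) :
    ∫ ψ in (-Real.pi)..Real.pi, frontIndicator A B ψ = Real.pi - Real.arccos (A / D) := by
  rcases le_total 0 B with hB | hB
  · exact integral_frontIndicator_of_nonneg hD h hB
  · rw [← integral_frontIndicator_of_nonneg (B := -B) hD (by simpa using h) (by linarith)]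
    simp only [← frontIndicator_neg A B]
    rw [intervalIntegral.integral_comp_neg (frontIndicator A B), neg_neg]

/-- Measure the normal from the direction `θ + π` that points from the RIS to the user. In this
rotated frame the user lies at `(t, 0)` and the BS at `(t - x cos θ, x sin θ)`. -/
lemma inFront_polar_iff (x t θ φ : ℝ) (ht : 0 < t) :
    (InFront (Complex.polarCoord.symm (t, θ)) φ 0 ∧
      InFront (Complex.polarCoord.symm (t, θ)) φ (x : ℂ)) ↔
    0 < Real.cos (φ - (θ + Real.pi)) ∧
      0 < (t - x * Real.cos θ) * Real.cos (φ - (θ + Real.pi)) +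
        x * Real.sin θ * Real.sin (φ - (θ + Real.pi)) := by
  have h1 : Real.cos (φ - (θ + Real.pi)) = -Real.cos (φ - θ) := by
    rw [← sub_sub, Real.cos_sub_pi]
  have h2 : Real.sin (φ - (θ + Real.pi)) = -Real.sin (φ - θ) := by
    rw [← sub_sub, Real.sin_sub_pi]
  have h3 : Real.cos φ = Real.cos (φ - θ) * Real.cos θ - Real.sin (φ - θ) * Real.sin θ := by
    rw [← Real.cos_add, sub_add_cancel]
  have hre : (Complex.polarCoord.symm (t, θ)).re = t * Real.cos θ := by
    simp [Complex.polarCoord_symm_apply, Complex.cos_ofReal_re, Complex.sin_ofReal_re]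
  have him : (Complex.polarCoord.symm (t, θ)).im = t * Real.sin θ := by
    simp [Complex.polarCoord_symm_apply, Complex.cos_ofReal_re, Complex.sin_ofReal_re]
  have e1 : (0 - t * Real.cos θ) * Real.cos φ + (0 - t * Real.sin θ) * Real.sin φ =
      t * Real.cos (φ - (θ + Real.pi)) := by
    rw [h1, Real.cos_sub]
    ring
  have e2 : (x - t * Real.cos θ) * Real.cos φ + (0 - t * Real.sin θ) * Real.sin φ =
      (t - x * Real.cos θ) * Real.cos (φ - (θ + Real.pi)) +
        x * Real.sin θ * Real.sin (φ - (θ + Real.pi)) := by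
    have : (x - t * Real.cos θ) * Real.cos φ + (0 - t * Real.sin θ) * Real.sin φ =
      x * Real.cos φ - t * Real.cos (φ - θ) := by
      rw [Real.cos_sub]
      ring
    rw [this, h1, h2, h3]
    ring
  simp only [InFront, hre, him, Complex.zero_re, Complex.zero_im, Complex.ofReal_re,
    Complex.ofReal_im, e1, e2, mul_pos_iff_of_pos_left ht]

lemma distBR_sq (x t θ : ℝ) :
    x ^ 2 + t ^ 2 - 2 * x * t * Real.cos θ =
      (t - x * Real.cos θ) ^ 2 + (x * Real.sin θ) ^ 2 := by
  nlinarith [Real.sin_sq_add_cos_sq θ]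

lemma unif_apply {a b : ℝ} (h : a < b) {s : Set ℝ} (hs : MeasurableSet s) :
    unif a b s = ENNReal.ofReal ((b - a)⁻¹ * ∫ u in a..b, s.indicator (fun _ => 1) u) := by
  have h1 : 0 < b - a := sub_pos.2 h
  rw [unif, cond_apply measurableSet_Icc, Real.volume_Icc, intervalIntegral.integral_of_le h.le,
    setIntegral_indicator hs, setIntegral_const, ENNReal.ofReal_mul (inv_nonneg.2 h1.le),
    ENNReal.ofReal_inv_of_pos h1, smul_eq_mul, mul_one, Measure.real,
    ENNReal.ofReal_toReal]
  · congr 1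
    exact measure_congr (Ioc_ae_eq_Icc.symm.inter (Filter.EventuallyEq.refl _ _))
  · exact ((measure_mono Set.inter_subset_left).trans_lt measure_Ioc_lt_top).ne

lemma isProbabilityMeasure_unif {a b : ℝ} (h : a < b) : IsProbabilityMeasure (unif a b) :=
  cond_isProbabilityMeasure_of_finite (by simpa using h) (by simp)

lemma measurableSet_inFront (z y : ℂ) : MeasurableSet {φ | InFront z φ y} :=
  measurableSet_lt measurable_const (by fun_prop)

/-- The assumption on `sin θ` keeps the RIS off the line through the user and the BS, so its
distance to the BS is positive. -/
lemma unif_inFront {x t θ : ℝ} (hx : 0 < x) (ht : 0 < t) (hθ : Real.sin θ ≠ 0) :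
    unif (-Real.pi) Real.pi {φ | InFront (Complex.polarCoord.symm (t, θ)) φ 0 ∧
      InFront (Complex.polarCoord.symm (t, θ)) φ (x : ℂ)} =
      ENNReal.ofReal (Params.probReflect x t θ) := by
  have hπ := Real.pi_pos
  have hm : MeasurableSet {φ | InFront (Complex.polarCoord.symm (t, θ)) φ 0 ∧
      InFront (Complex.polarCoord.symm (t, θ)) φ (x : ℂ)} :=
    (measurableSet_inFront _ _).inter (measurableSet_inFront _ _)
  rw [unif_apply (by linarith) hm]
  congr 1
  simp only [inFront_polar_iff x t θ _ ht]
  set A := t - x * Real.cos θ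
  set B := x * Real.sin θ
  have hB : B ≠ 0 := mul_ne_zero hx.ne' hθ
  have hpos : 0 < A ^ 2 + B ^ 2 := by positivity
  have h1 : ∫ φ in (-Real.pi)..Real.pi, frontIndicator A B (φ - (θ + Real.pi)) =
      Real.pi - Real.arccos (A / Real.sqrt (A ^ 2 + B ^ 2)) := by
    rw [intervalIntegral.integral_comp_sub_right (frontIndicator A B),
      ← integral_frontIndicator (Real.sqrt_pos.2 hpos) (Real.sq_sqrt hpos.le).symm]
    -- The rotation shifts the window of integration by `θ + π`; periodicity moves it back to `[-π,
    -- π]`.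
    have := (frontIndicator_periodic A B).intervalIntegral_add_eq (-Real.pi - (θ + Real.pi))
      (-Real.pi)
    rw [show -Real.pi - (θ + Real.pi) + 2 * Real.pi = Real.pi - (θ + Real.pi) by ring,
      show -Real.pi + 2 * Real.pi = Real.pi by ring] at this
    exact this
  have h2 : ∫ φ in (-Real.pi)..Real.pi, {φ | 0 < Real.cos (φ - (θ + Real.pi)) ∧
      0 < A * Real.cos (φ - (θ + Real.pi)) + B * Real.sin (φ - (θ + Real.pi))}.indicator
        (fun _ => (1 : ℝ)) φ = Real.pi - Real.arccos (A / Real.sqrt (A ^ 2 + B ^ 2)) := h1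
  rw [h2, Params.probReflect, distBR_sq]
  change _ = 1 / 2 - 1 / (2 * Real.pi) * Real.arccos (A / Real.sqrt (A ^ 2 + B ^ 2))
  generalize Real.arccos (A / Real.sqrt (A ^ 2 + B ^ 2)) = c
  field_simp
  ring

end Reflection

/-! ### Bounds, continuity and integrability of the RIS intensity -/

namespace Params

variable (p : Params)

lemma probReflect_nonneg (x t θ : ℝ) : 0 ≤ probReflect x t θ := by
  have h := Real.arccos_le_pi
    ((t - x * Real.cos θ) / Real.sqrt (x ^ 2 + t ^ 2 - 2 * x * t * Real.cos θ))
  have hπ := Real.pi_pos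
  rw [probReflect, sub_nonneg, one_div_mul_eq_div, div_le_iff₀ (by positivity)]
  linarith

lemma probReflect_le_one (x t θ : ℝ) : probReflect x t θ ≤ 1 := by
  have h := Real.arccos_nonneg
    ((t - x * Real.cos θ) / Real.sqrt (x ^ 2 + t ^ 2 - 2 * x * t * Real.cos θ))
  have hπ := Real.pi_pos
  have : 0 ≤ 1 / (2 * Real.pi) * Real.arccos
    ((t - x * Real.cos θ) / Real.sqrt (x ^ 2 + t ^ 2 - 2 * x * t * Real.cos θ)) := by positivity
  rw [probReflect]
  linarith

lemma measurable_probReflect :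
    Measurable fun z : ℝ × ℝ × ℝ => probReflect z.1 z.2.1 z.2.2 := by
  unfold probReflect
  refine measurable_const.sub (measurable_const.mul (Real.continuous_arccos.measurable.comp ?_))
  fun_prop

lemma beta_pos : 0 < p.beta := by
  have := p.lamO_pos
  have := p.Lo_pos
  have := Real.pi_pos
  unfold beta
  positivity

lemma lamR_nonneg : 0 ≤ p.lamR := mul_nonneg p.mu_nonneg p.lamO_pos.le

lemma probLoS_pos (t : ℝ) : 0 < p.probLoS t := Real.exp_pos _

lemma probLoS_le_one {t : ℝ} (ht : 0 ≤ t) : p.probLoS t ≤ 1 :=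
  Real.exp_le_one_iff.2 (by nlinarith [p.beta_pos])

lemma continuous_probLoS : Continuous p.probLoS := by
  unfold probLoS
  fun_prop

lemma a_nonneg (x t θ : ℝ) : 0 ≤ p.a x t θ :=
  mul_nonneg (p.probLoS_pos t).le (probReflect_nonneg x t θ)

lemma abar_eq (x t : ℝ) :
    p.abar x t = p.probLoS t * ∫ θ in (-Real.pi)..Real.pi, probReflect x t θ := by
  simp only [abar, a]
  exact intervalIntegral.integral_const_mul _ _

lemma abar_nonneg (x t : ℝ) : 0 ≤ p.abar x t :=
  intervalIntegral.integral_nonneg (by linarith [Real.pi_pos]) fun θ _ => p.a_nonneg x t θ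

lemma intervalIntegrable_probReflect (x t b c : ℝ) :
    IntervalIntegrable (fun θ => probReflect x t θ) volume b c := by
  refine (intervalIntegrable_const (c := (1 : ℝ))).mono_fun
    (measurable_probReflect.comp (by fun_prop : Measurable fun θ : ℝ =>
      (x, t, θ))).aestronglyMeasurable (.of_forall fun θ => ?_)
  simp only
  rw [Real.norm_of_nonneg (probReflect_nonneg _ _ _)]
  simpa using probReflect_le_one x t θ

lemma abar_le (x t : ℝ) : p.abar x t ≤ p.probLoS t * (2 * Real.pi) := by
  rw [abar_eq]
  refine mul_le_mul_of_nonneg_left ?_ (p.probLoS_pos t).le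
  have := intervalIntegral.integral_mono_on (a := -Real.pi) (b := Real.pi)
    (by linarith [Real.pi_pos]) (intervalIntegrable_probReflect x t _ _)
    (intervalIntegrable_const (c := (1 : ℝ)))
    fun θ _ => probReflect_le_one x t θ
  refine this.trans (le_of_eq ?_)
  simp
  ring

lemma ae_sin_ne_zero : ∀ᵐ θ : ℝ, Real.sin θ ≠ 0 := by
  have hc : {θ : ℝ | Real.sin θ = 0}.Countable := by
    have : {θ : ℝ | Real.sin θ = 0} = Set.range fun n : ℤ => (n : ℝ) * Real.pi := by
      ext θ
      simp [Real.sin_eq_zero_iff]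
    rw [this]
    exact Set.countable_range _
  exact (measure_eq_zero_iff_ae_notMem).1 (hc.measure_zero volume)

/-- Dominated convergence with bound 1: off the null set `sin θ = 0`, the distance in the
denominator of `probReflect` never vanishes, so the integrand is continuous in `t`. -/
lemma continuous_abar {x : ℝ} (hx : 0 < x) : Continuous (p.abar x) := by
  have h : Continuous fun t => ∫ θ in (-Real.pi)..Real.pi, probReflect x t θ := by
    refine intervalIntegral.continuous_of_dominated_interval (bound := fun _ => 1) (fun t => ?_)
      (fun t => .of_forall fun θ _ => ?_) intervalIntegrable_const ?_
    · exact (measurable_probReflect.comp (by fun_prop : Measurable fun θ : ℝ =>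
        (x, t, θ))).aestronglyMeasurable
    · rw [Real.norm_of_nonneg (probReflect_nonneg _ _ _)]
      exact probReflect_le_one x t θ
    · filter_upwards [ae_sin_ne_zero] with θ hθ _
      have hpos : ∀ t, Real.sqrt (x ^ 2 + t ^ 2 - 2 * x * t * Real.cos θ) ≠ 0 := fun t => by
        rw [distBR_sq]
        have : x * Real.sin θ ≠ 0 := mul_ne_zero hx.ne' hθ
        exact (Real.sqrt_pos.2 (by positivity)).ne'
      unfold probReflect
      refine continuous_const.sub (continuous_const.mul (Real.continuous_arccos.comp ?_))
      exact Continuous.div (by fun_prop) (by fun_prop) hpos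
  have : p.abar x = fun t => p.probLoS t * ∫ θ in (-Real.pi)..Real.pi, probReflect x t θ :=
    funext fun t => p.abar_eq x t
  rw [this]
  exact p.continuous_probLoS.mul h

/-- Blockage gives the dominating function `2π t exp (-β t)`. Hence the eligible RISs have finite
total intensity. -/
lemma integrableOn_abar_mul {x : ℝ} (hx : 0 < x) :
    IntegrableOn (fun t => p.abar x t * t) (Set.Ioi 0) := by
  have h := integrableOn_rpow_mul_exp_neg_mul_rpow (p := 1) (s := 1) (b := p.beta) (by norm_num)
    one_pos p.beta_pos
  refine (h.const_mul (2 * Real.pi)).mono'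
    ((p.continuous_abar hx).mul continuous_id).aestronglyMeasurable ?_
  filter_upwards [ae_restrict_mem measurableSet_Ioi] with t ht
  have ht' : 0 < t := ht
  rw [Real.norm_of_nonneg (mul_nonneg (p.abar_nonneg x t) ht'.le), Real.rpow_one]
  have := mul_le_mul_of_nonneg_right (p.abar_le x t) ht'.le
  rw [probLoS] at this
  linarith

end Params

/-! ## Intensity of the RISs that provide a cascaded link -/

section Intensity

lemma unif_zero_one_Iic {c : ℝ} (h1 : c ≤ 1) :
    unif 0 1 (Set.Iic c) = ENNReal.ofReal c := by
  have h : Set.Icc 0 1 ∩ Set.Iic c = Set.Icc 0 c := by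
    ext u
    simp only [Set.mem_inter_iff, Set.mem_Icc, Set.mem_Iic]
    constructor
    · exact fun h => ⟨h.1.1, h.2⟩
    · exact fun h => ⟨⟨h.1, h.2.trans h1⟩, h.2⟩
  rw [unif, cond_apply measurableSet_Icc, h]
  simp

lemma measurableSet_eligible_prod (p : Params) :
    MeasurableSet {z : ℝ × RIS | z.2 ∈ eligible p z.1} := by
  have h1 : MeasurableSet {z : ℝ × RIS | z.2.2.2 ≤ p.probLoS ‖z.2.1‖} :=
    measurableSet_le (by fun_prop) (p.continuous_probLoS.measurable.comp (by fun_prop))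
  have hre : Measurable fun z : ℝ × RIS => z.2.1.re := Complex.measurable_re.comp (by fun_prop)
  have him : Measurable fun z : ℝ × RIS => z.2.1.im := Complex.measurable_im.comp (by fun_prop)
  have h2 : MeasurableSet {z : ℝ × RIS | InFront z.2.1 z.2.2.1 0} := by
    refine measurableSet_lt measurable_const ?_
    fun_prop
  have h3 : MeasurableSet {z : ℝ × RIS | InFront z.2.1 z.2.2.1 (z.1 : ℂ)} := by
    simp only [InFront, Complex.ofReal_re, Complex.ofReal_im]
    refine measurableSet_lt measurable_const ?_
    fun_prop
  exact h1.inter (h2.inter h3)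

lemma measurableSet_eligible (p : Params) (x : ℝ) : MeasurableSet (eligible p x) :=
  measurable_prodMk_left (measurableSet_eligible_prod p)

/-- The intensity measure of the RISs with their marks. -/
def risIntensity (p : Params) : Measure RIS :=
  (ENNReal.ofReal p.lamR • (volume : Measure ℂ)).prod ((unif (-Real.pi) Real.pi).prod (unif 0 1))

/-- At a given position, orientation and LoS mark are independent, so the eligible marks form a
product set. -/
lemma measure_eligible_section (p : Params) {x t θ : ℝ} (hx : 0 < x) (ht : 0 < t)
    (hθ : Real.sin θ ≠ 0) :
    ((unif (-Real.pi) Real.pi).prod (unif 0 1))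
        {y | (Complex.polarCoord.symm (t, θ), y) ∈ eligible p x} =
      ENNReal.ofReal (p.a x t θ) := by
  have := isProbabilityMeasure_unif (show -Real.pi < Real.pi by linarith [Real.pi_pos])
  have := isProbabilityMeasure_unif (zero_lt_one' ℝ)
  have h : {y | (Complex.polarCoord.symm (t, θ), y) ∈ eligible p x} =
      {φ | InFront (Complex.polarCoord.symm (t, θ)) φ 0 ∧
        InFront (Complex.polarCoord.symm (t, θ)) φ (x : ℂ)} ×ˢ Set.Iic (p.probLoS t) := by
    ext y
    simp only [eligible, Set.mem_ofPred_eq, Set.mem_prod, Set.mem_Iic, Complex.norm_polarCoord_symm,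
      abs_of_pos ht]
    tauto
  rw [h, Measure.prod_prod, unif_inFront hx ht hθ,
    unif_zero_one_Iic (p.probLoS_le_one ht.le), Params.a, mul_comm,
    ENNReal.ofReal_mul (p.probLoS_pos t).le]

/-- Integrate first over the marks, then over the position in polar coordinates, whose Jacobian is
the factor `t`. A general `D` covers both discs and the whole plane. -/
lemma risIntensity_eligible (p : Params) {x : ℝ} (hx : 0 < x) {D : Set ℝ} (hD : MeasurableSet D) :
    risIntensity p {z | z ∈ eligible p x ∧ ‖z.1‖ ∈ D} =
      ENNReal.ofReal (∫ t in Set.Ioi 0 ∩ D, p.lamR * (p.abar x t * t)) := by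
  have := isProbabilityMeasure_unif (show -Real.pi < Real.pi by linarith [Real.pi_pos])
  have := isProbabilityMeasure_unif (zero_lt_one' ℝ)
  have hT : MeasurableSet {z : RIS | z ∈ eligible p x ∧ ‖z.1‖ ∈ D} :=
    (measurableSet_eligible p x).inter (measurable_fst.norm hD)
  set F : ℂ → ℝ≥0∞ := fun z => ((unif (-Real.pi) Real.pi).prod (unif 0 1))
    (Prod.mk z ⁻¹' {z : RIS | z ∈ eligible p x ∧ ‖z.1‖ ∈ D}) with hF
  have hFm : Measurable F := measurable_measure_prodMk_left hT
  have hpolar : Measurable fun q : ℝ × ℝ => Complex.polarCoord.symm q := by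
    simp only [Complex.polarCoord_symm_apply]
    fun_prop
  have hinner : ∀ t ∈ Set.Ioi (0 : ℝ),
      ∫⁻ θ in Set.Ioo (-Real.pi) Real.pi,
        ENNReal.ofReal t * F (Complex.polarCoord.symm (t, θ)) =
      D.indicator (fun t => ENNReal.ofReal (p.abar x t * t)) t := by
    intro t ht
    have ht' : 0 < t := ht
    -- Directions with `sin θ = 0`, where the arc computation may degenerate, are negligible.
    have hFe : ∀ᵐ θ ∂(volume.restrict (Set.Ioo (-Real.pi) Real.pi)),
        ENNReal.ofReal t * F (Complex.polarCoord.symm (t, θ)) =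
          D.indicator (fun t => ENNReal.ofReal (p.a x t θ * t)) t := by
      filter_upwards [ae_restrict_of_ae Params.ae_sin_ne_zero] with θ hθ
      by_cases htD : t ∈ D
      · have : Prod.mk (Complex.polarCoord.symm (t, θ)) ⁻¹'
            {z : RIS | z ∈ eligible p x ∧ ‖z.1‖ ∈ D} =
            {y | (Complex.polarCoord.symm (t, θ), y) ∈ eligible p x} := by
          ext y
          simp [abs_of_pos ht', htD]
        rw [Set.indicator_of_mem htD, hF]
        simp only
        rw [this, measure_eligible_section p hx ht' hθ, mul_comm,
          ENNReal.ofReal_mul (p.a_nonneg _ _ _)]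
      · have : Prod.mk (Complex.polarCoord.symm (t, θ)) ⁻¹'
            {z : RIS | z ∈ eligible p x ∧ ‖z.1‖ ∈ D} = ∅ := by
          ext y
          simp [abs_of_pos ht', htD]
        rw [Set.indicator_of_notMem htD, hF]
        simp only
        rw [this]
        simp
    rw [lintegral_congr_ae hFe]
    by_cases htD : t ∈ D
    · simp only [Set.indicator_of_mem htD]
      have hint : IntervalIntegrable (fun θ => p.a x t θ * t) volume (-Real.pi) Real.pi := by
        simp only [Params.a]
        exact ((Params.intervalIntegrable_probReflect x t _ _).const_mul _).mul_const _
      rw [← ofReal_integral_eq_lintegral_ofReal, ← integral_Ioc_eq_integral_Ioo,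
        ← intervalIntegral.integral_of_le (by linarith [Real.pi_pos]),
        intervalIntegral.integral_mul_const, Params.abar]
      · exact (intervalIntegrable_iff_integrableOn_Ioo_of_le
          (by linarith [Real.pi_pos])).1 hint
      · exact .of_forall fun θ => mul_nonneg (p.a_nonneg _ _ _) ht'.le
    · simp [Set.indicator_of_notMem htD]
  have hFi : ∫⁻ z, F z = ∫⁻ t in Set.Ioi 0 ∩ D, ENNReal.ofReal (p.abar x t * t) := by
    rw [← Complex.lintegral_comp_polarCoord_symm, polarCoord_target, Measure.volume_eq_prod,
      ← Measure.prod_restrict, lintegral_prod]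
    · refine (setLIntegral_congr_fun measurableSet_Ioi hinner).trans ?_
      rw [lintegral_indicator hD, Measure.restrict_restrict hD, Set.inter_comm]
    · exact ((measurable_fst.ennreal_ofReal).mul (hFm.comp hpolar)).aemeasurable
  rw [risIntensity, Measure.prod_apply hT, lintegral_smul_measure, smul_eq_mul, hFi,
    integral_const_mul, ENNReal.ofReal_mul p.lamR_nonneg, ofReal_integral_eq_lintegral_ofReal]
  · exact (p.integrableOn_abar_mul hx).mono_set Set.inter_subset_left
  · filter_upwards [ae_restrict_mem (measurableSet_Ioi.inter hD)] with t ht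
    exact mul_nonneg (p.abar_nonneg x t) (le_of_lt ht.1)

lemma risIntensity_eligible_Iic (p : Params) {x : ℝ} (hx : 0 < x) {r : ℝ} (hr : 0 ≤ r) :
    risIntensity p {z | z ∈ eligible p x ∧ ‖z.1‖ ≤ r} =
      ENNReal.ofReal (∫ t in (0 : ℝ)..r, p.lamR * (p.abar x t * t)) := by
  have := risIntensity_eligible p hx (measurableSet_Iic (a := r))
  rw [intervalIntegral.integral_of_le hr, ← Set.Ioi_inter_Iic]
  exact this

lemma risIntensity_eligible_univ (p : Params) {x : ℝ} (hx : 0 < x) :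
    risIntensity p (eligible p x) =
      ENNReal.ofReal (p.lamR * ∫ t in Set.Ioi (0 : ℝ), p.abar x t * t) := by
  have := risIntensity_eligible p hx MeasurableSet.univ
  simpa [integral_const_mul] using this

end Intensity

/-! ## Distribution of the BS-user distance -/

lemma firstContact_univ (ω : Measure ℂ) :
    firstContact id ω Set.univ = sInf {r : ℝ | 0 < ω {x | ‖x‖ ≤ r}} := by
  simp [firstContact]

lemma Network.tbu_eq {Ω : Type*} (N : Network Ω) :
    N.tbu = fun ω => firstContact id (N.bs ω) Set.univ :=
  funext fun ω => (firstContact_univ (N.bs ω)).symm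

section BaseStations

variable {Ω : Type*} [MeasurableSpace Ω] {P : Measure Ω} {p : Params} {N : Network Ω}

/-- The area `π r ^ 2` is written as an integral over radii, the form required by
`map_firstContact`. -/
lemma bsIntensity_Iic (p : Params) {r : ℝ} (hr : 0 ≤ r) :
    (ENNReal.ofReal p.lamB • (volume : Measure ℂ)) {x | x ∈ Set.univ ∧ ‖id x‖ ≤ r} =
      ENNReal.ofReal (∫ t in (0 : ℝ)..r, 2 * Real.pi * p.lamB * t) := by
  have h : {x : ℂ | x ∈ Set.univ ∧ ‖id x‖ ≤ r} = Metric.closedBall 0 r := by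
    ext x
    simp
  rw [h, Measure.smul_apply, Complex.volume_closedBall, intervalIntegral.integral_const_mul,
    integral_id, smul_eq_mul, ← ENNReal.ofReal_pow hr,
    show (NNReal.pi : ℝ≥0∞) = ENNReal.ofReal Real.pi by
      rw [← NNReal.coe_real_pi, ENNReal.ofReal_coe_nnreal],
    ← ENNReal.ofReal_mul (by positivity), ← ENNReal.ofReal_mul p.lamB_pos.le]
  congr 1
  ring

namespace Network.IsModel

/-- An empty plane implies an empty disc of radius `n + 1` for every `n`, of probability at most
`exp (-n π λ)` because `(n + 1) ^ 2 ≥ n`. -/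
lemma ae_bs_pos [IsProbabilityMeasure P] (hN : N.IsModel p P) : ∀ᵐ ω ∂P, 0 < N.bs ω Set.univ := by
  have hlam := p.lamB_pos
  have hle : ∀ n : ℕ, P {ω | N.bs ω Set.univ = 0} ≤
      ENNReal.ofReal (Real.exp (-(n : ℝ) * (Real.pi * p.lamB))) := by
    intro n
    have hfin := bsIntensity_Iic p (Nat.cast_nonneg' (n + 1))
    have hm : MeasurableSet {x : ℂ | x ∈ Set.univ ∧ ‖id x‖ ≤ ((n + 1 : ℕ) : ℝ)} :=
      MeasurableSet.univ.inter (measurableSet_le measurable_id.norm measurable_const)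
    have h0 : 0 ≤ ∫ t in (0 : ℝ)..((n + 1 : ℕ) : ℝ), 2 * Real.pi * p.lamB * t :=
      intervalIntegral.integral_nonneg (Nat.cast_nonneg' _) fun t ht => by
        have := ht.1
        positivity
    refine (measure_mono (t := {ω | N.bs ω {x | x ∈ Set.univ ∧ ‖id x‖ ≤ ((n + 1 : ℕ) : ℝ)} = 0})
      fun ω hω => measure_mono_null (Set.subset_univ _) hω).trans ?_
    rw [hN.bs_poisson.measure_void hm (by rw [hfin]; simp), hfin, ENNReal.toReal_ofReal h0]
    refine ENNReal.ofReal_le_ofReal (Real.exp_le_exp.2 ?_)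
    rw [intervalIntegral.integral_const_mul, integral_id]
    push_cast
    have : 0 < Real.pi * p.lamB := by positivity
    nlinarith [Nat.cast_nonneg (α := ℝ) n, mul_nonneg this.le (sq_nonneg (n : ℝ))]
  have hlim : Filter.Tendsto
      (fun n : ℕ => ENNReal.ofReal (Real.exp (-(n : ℝ) * (Real.pi * p.lamB)))) Filter.atTop
      (nhds 0) := by
    rw [← ENNReal.ofReal_zero]
    refine ENNReal.tendsto_ofReal (Real.tendsto_exp_atBot.comp ?_)
    exact (Filter.tendsto_neg_atTop_atBot.comp tendsto_natCast_atTop_atTop).atBot_mul_const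
      (by positivity)
  have h0 : P {ω | N.bs ω Set.univ = 0} = 0 :=
    le_antisymm (ge_of_tendsto' hlim hle) bot_le
  filter_upwards [measure_eq_zero_iff_ae_notMem.1 h0] with ω hω
  exact pos_iff_ne_zero.2 hω

lemma measurable_tbu (hN : N.IsModel p P) : Measurable N.tbu := by
  rw [N.tbu_eq]
  exact hN.bs_poisson.measurable_firstContact measurable_id .univ

/-- Almost surely there is a base station, so the restriction in `map_firstContact` disappears and
the law has full mass. -/
lemma map_tbu [IsProbabilityMeasure P] (hN : N.IsModel p P) : P.map N.tbu =
    (volume.restrict (Set.Ioi 0)).withDensity fun y => ENNReal.ofReal (p.pdfBU y) := by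
  have hlam := p.lamB_pos
  have h := hN.bs_poisson.map_firstContact measurable_id .univ
    (g := fun t => 2 * Real.pi * p.lamB * t) (by fun_prop) (fun t ht => by positivity)
    fun r hr => bsIntensity_Iic p hr
  rw [N.tbu_eq]
  have hrestr : P.restrict {ω | 0 < N.bs ω Set.univ} = P :=
    Measure.restrict_eq_self_of_ae_mem hN.ae_bs_pos
  rw [hrestr] at h
  rw [h]
  congr 1
  ext y
  rw [Params.pdfBU, intervalIntegral.integral_const_mul, integral_id]
  congr 4
  ring

end Network.IsModel

end BaseStations

/-! ## Measurability of powers, interference and SINR -/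

instance : Finite LinkType :=
  Finite.of_surjective (fun i : Fin 3 => ![LinkType.DL, LinkType.CL, LinkType.DN] i) fun q => by
    cases q
    exacts [⟨0, rfl⟩, ⟨1, rfl⟩, ⟨2, rfl⟩]

instance : DiscreteMeasurableSpace LinkType := ⟨fun _ => MeasurableSpace.measurableSet_top⟩

namespace Params

variable (p : Params)

lemma measurable_power (q : LinkType) : Measurable (p.power q) := by
  cases q
  · change Measurable fun d : Distances =>
      if d.1 < p.Tmax then p.p0 * d.1 ^ (p.alphaL * p.eps) else p.pmax
    exact Measurable.ite (measurableSet_lt (by fun_prop) (by fun_prop)) (by fun_prop) (by fun_prop)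
  · change Measurable fun d : Distances =>
      if d.2.2 * d.2.1 < p.Tmax * p.Gr ^ (1 / p.alphaL)
      then p.p0 * ((d.2.2 * d.2.1) ^ p.alphaL * p.Gr⁻¹) ^ p.eps else p.pmax
    exact Measurable.ite (measurableSet_lt (by fun_prop) (by fun_prop)) (by fun_prop) (by fun_prop)
  · change Measurable fun d : Distances =>
      if d.1 < p.Tmax ^ (p.alphaL / p.alphaN) then p.p0 * d.1 ^ (p.alphaN * p.eps) else p.pmax
    exact Measurable.ite (measurableSet_lt (by fun_prop) (by fun_prop)) (by fun_prop) (by fun_prop)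

lemma measurable_received (q : LinkType) :
    Measurable fun z : Distances × ℝ => p.received q z.1 z.2 := by
  have h : Measurable fun z : Distances × ℝ => p.power q z.1 :=
    (p.measurable_power q).comp measurable_fst
  cases q
  · change Measurable fun z : Distances × ℝ =>
      p.power .DL z.1 * p.Gb * p.zeta * z.1.1 ^ (-p.alphaL) * z.2
    exact (((h.mul_const _).mul_const _).mul (by fun_prop)).mul measurable_snd
  · change Measurable fun z : Distances × ℝ =>
      p.power .CL z.1 * p.Gr * p.Gb * p.zeta * (z.1.2.1 * z.1.2.2) ^ (-p.alphaL) * z.2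
    exact ((((h.mul_const _).mul_const _).mul_const _).mul (by fun_prop)).mul measurable_snd
  · change Measurable fun z : Distances × ℝ =>
      p.power .DN z.1 * p.Gb * p.zeta * z.1.1 ^ (-p.alphaN) * z.2
    exact (((h.mul_const _).mul_const _).mul (by fun_prop)).mul measurable_snd

lemma measurable_exposure (q : LinkType) : Measurable (p.exposure q) :=
  (p.measurable_power q).const_mul _

lemma measurable_gainLobe : Measurable p.gainLobe := by
  unfold gainLobe
  refine Measurable.ite measurableSet_Iic measurable_const
    (Finset.measurable_sum _ fun n _ => Measurable.ite ?_ measurable_const measurable_const)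
  exact measurableSet_Ioc

lemma measurable_gainB : Measurable p.gainB := by
  unfold gainB
  exact Measurable.ite (measurableSet_le (by fun_prop) (by fun_prop))
    (p.measurable_gainLobe.comp (by fun_prop)) (p.measurable_gainLobe.comp (by fun_prop))

lemma measurable_interfPower : Measurable (interfPower p) := by
  have h : Measurable fun z : LinkType × Distances => p.power z.1 z.2 :=
    measurable_from_prod_countable_right fun q => p.measurable_power q
  change Measurable fun z : Interferer =>
    p.power z.2.1.1 z.2.1.2 *
      p.gainB (1 / 2 * Real.cos z.2.2.2.1.1 - 1 / 2 * Real.cos z.2.2.2.1.2) * p.zeta *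
      (if z.2.2.1 ≤ p.probLoS ‖z.1‖ then ‖z.1‖ ^ (-p.alphaL) * z.2.2.2.2.1
        else ‖z.1‖ ^ (-p.alphaN) * z.2.2.2.2.2)
  refine (((h.comp measurable_snd.fst).mul (p.measurable_gainB.comp (by fun_prop))).mul_const _).mul
    (Measurable.ite (measurableSet_le (by fun_prop) (p.continuous_probLoS.measurable.comp
      (by fun_prop))) (by fun_prop) (by fun_prop))

/-- The uplink SINR as a function of the distances, the fading coefficient and the interferers. -/
def sinrFun (q : LinkType) (d : Distances) (y : ℝ × Measure Interferer) : ℝ :=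
  (ENNReal.ofReal (p.received q d y.1) /
    (ENNReal.ofReal p.noise + ∫⁻ x, ENNReal.ofReal (interfPower p x) ∂y.2)).toReal

lemma measurable_sinrFun (q : LinkType) :
    Measurable fun z : Distances × (ℝ × Measure Interferer) => p.sinrFun q z.1 z.2 := by
  have h1 : Measurable fun z : Distances × (ℝ × Measure Interferer) => p.received q z.1 z.2.1 :=
    (p.measurable_received q).comp (measurable_fst.prodMk measurable_snd.fst)
  have h2 : Measurable fun z : Distances × (ℝ × Measure Interferer) =>
      ∫⁻ x, ENNReal.ofReal (interfPower p x) ∂z.2.2 :=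
    (Measure.measurable_lintegral p.measurable_interfPower.ennreal_ofReal).comp measurable_snd.snd
  exact (h1.ennreal_ofReal.div (measurable_const.add h2)).ennreal_toReal

end Params

lemma Network.sinrAt_eq {Ω : Type*} (N : Network Ω) (p : Params) (q : LinkType) (d : Distances)
    (ω : Ω) : N.sinrAt p q d ω = p.sinrFun q d (N.fading q ω, N.iu ω) := rfl

/-! ## Distances and type of the serving link as functions of the random sources -/

/-- The number of RISs that provide a cascaded link, as a function of the BS-user distance and of
the RISs. -/
def eligibleMass (p : Params) (x : ℝ) (R : Measure RIS) : ℝ≥0∞ :=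
  locallyFiniteKernel (pos := (Prod.fst : RIS → ℂ)) measurable_fst R (eligible p x)

/-- The RIS-user distance as a function of the BS-user distance and of the RISs. -/
def contactRIS (p : Params) (x : ℝ) (R : Measure RIS) : ℝ :=
  firstContact Prod.fst (locallyFiniteKernel (pos := (Prod.fst : RIS → ℂ)) measurable_fst R)
    (eligible p x)

lemma measurable_eligibleMass (p : Params) :
    Measurable fun z : ℝ × Measure RIS => eligibleMass p z.1 z.2 :=
  measurable_locallyFiniteKernel_section (pos := (Prod.fst : RIS → ℂ)) measurable_fst
    (measurableSet_eligible_prod p)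

lemma measurable_contactRIS (p : Params) :
    Measurable fun z : ℝ × Measure RIS => contactRIS p z.1 z.2 := by
  refine measurable_firstContact fun r => ?_
  refine measurable_locallyFiniteKernel_section (pos := (Prod.fst : RIS → ℂ)) measurable_fst
    (A := fun x : ℝ => {z | z ∈ eligible p x ∧ ‖z.1‖ ≤ r}) ?_
  exact (measurableSet_eligible_prod p).inter
    (measurableSet_le measurable_snd.fst.norm measurable_const)

open Classical in
/-- The type of the serving link as a function of the BS-user distance, the RISs and the LoS
mark. -/
def linkFun (p : Params) (x : ℝ) (R : Measure RIS) (u : ℝ) : LinkType :=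
  if u ≤ p.probLoS x then .DL else if 0 < eligibleMass p x R then .CL else .DN

lemma measurable_linkFun (p : Params) :
    Measurable fun z : ℝ × Measure RIS × ℝ => linkFun p z.1 z.2.1 z.2.2 := by
  unfold linkFun
  refine Measurable.ite (measurableSet_le (by fun_prop)
    (p.continuous_probLoS.measurable.comp (by fun_prop))) measurable_const
    (Measurable.ite (measurableSet_lt measurable_const ?_) measurable_const measurable_const)
  exact (measurable_eligibleMass p).comp (measurable_fst.prodMk measurable_snd.fst)

/-- The distances of the serving link as a function of the BS-user distance, the RISs and the
angle. -/
def distFun (p : Params) (x : ℝ) (R : Measure RIS) (θ : ℝ) : Distances :=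
  (x, contactRIS p x R, Params.distBR x (contactRIS p x R) θ)

lemma measurable_distBR : Measurable fun z : ℝ × ℝ × ℝ => Params.distBR z.1 z.2.1 z.2.2 := by
  unfold Params.distBR
  fun_prop

lemma measurable_distFun (p : Params) :
    Measurable fun z : ℝ × Measure RIS × ℝ => distFun p z.1 z.2.1 z.2.2 := by
  have h0 : Measurable fun z : ℝ × Measure RIS × ℝ => (z.1, z.2.1) :=
    measurable_fst.prodMk measurable_snd.fst
  have h := (measurable_contactRIS p).comp h0
  have h' : Measurable fun z : ℝ × Measure RIS × ℝ =>
      (z.1, contactRIS p z.1 z.2.1, z.2.2) := measurable_fst.prodMk (h.prodMk measurable_snd.snd)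
  have h'' := measurable_distBR.comp h'
  exact measurable_fst.prodMk (h.prodMk h'')

lemma measurable_firstContact_univ : Measurable fun m : Measure ℂ => firstContact id m Set.univ :=
  measurable_firstContact fun _ =>
    Measure.measurable_coe (MeasurableSet.univ.inter
      (measurableSet_le measurable_id.norm measurable_const))

namespace Network.IsModel

variable {Ω : Type*} [MeasurableSpace Ω] {P : Measure Ω} {p : Params} {N : Network Ω}

/-- Realisations are locally finite for every `ω`, so the truncation built into the kernel never
acts on them. -/
lemma locallyFiniteKernel_ris (hN : N.IsModel p P) (ω : Ω) :
    locallyFiniteKernel (pos := (Prod.fst : RIS → ℂ)) measurable_fst (N.ris ω) = N.ris ω :=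
  locallyFiniteKernel_apply _ (hN.ris_poisson.mem_locallyFinite ω)

lemma eligibleMass_ris (hN : N.IsModel p P) (x : ℝ) (ω : Ω) :
    eligibleMass p x (N.ris ω) = N.ris ω (eligible p x) := by
  rw [eligibleMass, hN.locallyFiniteKernel_ris]

lemma contactRIS_ris (hN : N.IsModel p P) (x : ℝ) (ω : Ω) :
    contactRIS p x (N.ris ω) = firstContact Prod.fst (N.ris ω) (eligible p x) := by
  rw [contactRIS, hN.locallyFiniteKernel_ris]

lemma link_eq (hN : N.IsModel p P) (ω : Ω) :
    N.link p ω = linkFun p (N.tbu ω) (N.ris ω) (N.mark ω) := by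
  rw [link, linkFun, hN.eligibleMass_ris]

lemma dist_eq (hN : N.IsModel p P) (ω : Ω) :
    N.dist p ω = distFun p (N.tbu ω) (N.ris ω) (N.theta ω) := by
  simp only [distFun, hN.contactRIS_ris]
  rfl

lemma sources_le (hN : N.IsModel p P) (i : Fin 8) : N.sources i ≤ ‹MeasurableSpace Ω› := by
  fin_cases i
  exacts [hN.bs_poisson.measurable.comap_le, hN.ris_poisson.measurable.comap_le,
    hN.mark_measurable.comap_le, hN.theta_measurable.comap_le, (hN.fading_measurable _).comap_le,
    (hN.fading_measurable _).comap_le, (hN.fading_measurable _).comap_le,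
    hN.iu_poisson.measurable.comap_le]

/-- Disjoint blocks of independent σ-algebras generate independent σ-algebras. Every independence
statement below is an instance with explicit blocks. -/
lemma indepFun {α β : Type*} [MeasurableSpace α] [MeasurableSpace β] (hN : N.IsModel p P)
    {S T : Set (Fin 8)} (hST : Disjoint S T) {f : Ω → α} {g : Ω → β}
    (hf : Measurable[⨆ i ∈ S, N.sources i] f) (hg : Measurable[⨆ i ∈ T, N.sources i] g) :
    IndepFun f g P :=
  (IndepFun_iff_Indep f g P).2
    (indep_of_indep_of_le_left (indep_of_indep_of_le_right
      (indep_iSup_of_disjoint hN.sources_le hN.indep hST) hg.comap_le) hf.comap_le)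

end Network.IsModel

namespace Network

variable {Ω : Type*} (N : Network Ω)

lemma measurable_of_source {α : Type*} [MeasurableSpace α] {f : Ω → α} {S : Set (Fin 8)}
    {i : Fin 8} (hi : i ∈ S) (h : MeasurableSpace.comap f inferInstance ≤ N.sources i) :
    Measurable[⨆ i ∈ S, N.sources i] f :=
  measurable_iff_comap_le.2 (h.trans (le_biSup N.sources hi))

lemma measurable_fading_source (q : LinkType) :
    Measurable[⨆ i ∈ ({4, 5, 6, 7} : Set (Fin 8)), N.sources i] (N.fading q) := by
  cases q
  exacts [N.measurable_of_source (i := 4) (by simp) le_rfl,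
    N.measurable_of_source (i := 5) (by simp) le_rfl,
    N.measurable_of_source (i := 6) (by simp) le_rfl]

end Network

/-! ### Independence of geometry and channel -/

namespace Network.IsModel

variable {Ω : Type*} [MeasurableSpace Ω] {P : Measure Ω} {p : Params} {N : Network Ω}

lemma indepFun_geometry_channel (hN : N.IsModel p P) (q : LinkType) :
    IndepFun (fun ω => (N.bs ω, N.ris ω, N.mark ω, N.theta ω))
      (fun ω => (N.fading q ω, N.iu ω)) P := by
  refine hN.indepFun (S := {0, 1, 2, 3}) (T := {4, 5, 6, 7}) ?_ ?_ ?_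
  · rw [Set.disjoint_left]
    decide
  · exact (N.measurable_of_source (i := 0) (by simp) le_rfl).prodMk
      ((N.measurable_of_source (i := 1) (by simp) le_rfl).prodMk
        ((N.measurable_of_source (i := 2) (by simp) le_rfl).prodMk
          (N.measurable_of_source (i := 3) (by simp) le_rfl)))
  · exact (N.measurable_fading_source q).prodMk (N.measurable_of_source (i := 7) (by simp) le_rfl)

lemma indepFun_tbu (hN : N.IsModel p P) :
    IndepFun N.tbu (fun ω => (N.ris ω, N.mark ω, N.theta ω)) P := by
  have h : IndepFun N.bs (fun ω => (N.ris ω, N.mark ω, N.theta ω)) P := by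
    refine hN.indepFun (S := {0}) (T := {1, 2, 3}) ?_ ?_ ?_
    · rw [Set.disjoint_left]
      decide
    · exact N.measurable_of_source (i := 0) (by simp) le_rfl
    · exact (N.measurable_of_source (i := 1) (by simp) le_rfl).prodMk
        ((N.measurable_of_source (i := 2) (by simp) le_rfl).prodMk
          (N.measurable_of_source (i := 3) (by simp) le_rfl))
  rw [N.tbu_eq]
  exact h.comp measurable_firstContact_univ measurable_id

lemma indepFun_mark (hN : N.IsModel p P) :
    IndepFun N.mark (fun ω => (N.ris ω, N.theta ω)) P := by
  refine hN.indepFun (S := {2}) (T := {1, 3}) ?_ ?_ ?_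
  · rw [Set.disjoint_left]
    decide
  · exact N.measurable_of_source (i := 2) (by simp) le_rfl
  · exact (N.measurable_of_source (i := 1) (by simp) le_rfl).prodMk
      (N.measurable_of_source (i := 3) (by simp) le_rfl)

lemma indepFun_ris_theta (hN : N.IsModel p P) : IndepFun N.ris N.theta P := by
  refine hN.indepFun (S := {1}) (T := {3}) ?_ ?_ ?_
  · rw [Set.disjoint_left]
    decide
  · exact N.measurable_of_source (i := 1) (by simp) le_rfl
  · exact N.measurable_of_source (i := 3) (by simp) le_rfl

lemma measurable_channel (hN : N.IsModel p P) (q : LinkType) :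
    Measurable fun ω => (N.fading q ω, N.iu ω) :=
  (hN.fading_measurable q).prodMk hN.iu_poisson.measurable

/-- The type and the distances of the serving link are independent of the fading and of the
interferers. -/
lemma indepFun_serving (hN : N.IsModel p P) (q : LinkType) :
    IndepFun (fun ω => (N.link p ω, N.dist p ω)) (fun ω => (N.fading q ω, N.iu ω)) P := by
  have hl : Measurable fun z : Measure ℂ × Measure RIS × ℝ × ℝ =>
      linkFun p (firstContact id z.1 Set.univ) z.2.1 z.2.2.1 :=
    (measurable_linkFun p).comp ((measurable_firstContact_univ.comp measurable_fst).prodMk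
      (measurable_snd.fst.prodMk measurable_snd.snd.fst))
  have hd : Measurable fun z : Measure ℂ × Measure RIS × ℝ × ℝ =>
      distFun p (firstContact id z.1 Set.univ) z.2.1 z.2.2.2 :=
    (measurable_distFun p).comp ((measurable_firstContact_univ.comp measurable_fst).prodMk
      (measurable_snd.fst.prodMk measurable_snd.snd.snd))
  have h := (hN.indepFun_geometry_channel q).comp (hl.prodMk hd) measurable_id
  have he : (fun ω => (N.link p ω, N.dist p ω)) =
      (fun z : Measure ℂ × Measure RIS × ℝ × ℝ =>
        (linkFun p (firstContact id z.1 Set.univ) z.2.1 z.2.2.1,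
          distFun p (firstContact id z.1 Set.univ) z.2.1 z.2.2.2)) ∘
        fun ω => (N.bs ω, N.ris ω, N.mark ω, N.theta ω) := by
    ext1 ω
    rw [hN.link_eq, hN.dist_eq, N.tbu_eq]
    rfl
  rw [he]
  exact h

lemma measurable_serving (hN : N.IsModel p P) :
    Measurable fun ω => (N.link p ω, N.dist p ω) := by
  have ht := hN.measurable_tbu
  simp only [hN.link_eq, hN.dist_eq]
  exact ((measurable_linkFun p).comp (ht.prodMk
    (hN.ris_poisson.measurable.prodMk hN.mark_measurable))).prodMk
    ((measurable_distFun p).comp (ht.prodMk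
      (hN.ris_poisson.measurable.prodMk hN.theta_measurable)))

end Network.IsModel

/-! ## Conditional probabilities given the distances -/

/-- Replacing the distances that are irrelevant for a link of type `q` by `0`. -/
def relevant : LinkType → Distances → Distances
  | .CL, d => d
  | _, d => (d.1, 0, 0)

lemma measurable_relevant (q : LinkType) : Measurable (relevant q) := by
  cases q
  · exact measurable_fst.prodMk measurable_const
  · exact measurable_id
  · exact measurable_fst.prodMk measurable_const

/-- Allows conditioning on the relevant distances only: a direct link never reads the other two. -/
lemma Params.sinrFun_relevant (p : Params) (q : LinkType) (d : Distances)
    (y : ℝ × Measure Interferer) : p.sinrFun q (relevant q d) y = p.sinrFun q d y := by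
  cases q <;> rfl

lemma Params.exposure_relevant (p : Params) (q : LinkType) (d : Distances) :
    p.exposure q (relevant q d) = p.exposure q d := by
  cases q <;> rfl

namespace Network

variable {Ω : Type*} (N : Network Ω) (p : Params)

lemma relDist_eq (q : LinkType) (ω : Ω) : N.relDist p q ω = relevant q (N.dist p ω) := by
  cases q <;> rfl

lemma sinrOf_eq (q : LinkType) (ω : Ω) :
    N.sinrOf p q ω = p.sinrFun q (N.relDist p q ω) (N.fading q ω, N.iu ω) := by
  rw [relDist_eq, Params.sinrFun_relevant]
  rfl

lemma exposureOf_eq (q : LinkType) (ω : Ω) :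
    N.exposureOf p q ω = p.exposure q (N.relDist p q ω) := by
  rw [relDist_eq, Params.exposure_relevant]
  rfl

variable [MeasurableSpace Ω] (P : Measure Ω)

/-- At fixed `d` the exposure condition does not involve `ω`: it either leaves the coverage event
intact or empties it. This is the source of the product form. -/
lemma condJoint_eq (γ w : ℝ) (q : LinkType) (d : Distances) :
    P.real {ω | γ < p.sinrFun q d (N.fading q ω, N.iu ω) ∧ p.exposure q d ≤ w} =
      N.condJoint p P γ w q d := by
  by_cases h : p.exposure q d ≤ w
  · simp only [h, and_true, condJoint, condCompliance, if_true, mul_one, condCoverage, sinrAt_eq]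
  · simp [h, condJoint, condCompliance]

variable {P p} {N}

lemma IsModel.measurable_condJoint [IsProbabilityMeasure P] (hN : N.IsModel p P) (γ w : ℝ)
    (q : LinkType) :
    Measurable (N.condJoint p P γ w q) := by
  have h := measurable_real_section (P := P) (hN.measurable_channel q)
    (A := {z : Distances × (ℝ × Measure Interferer) |
      γ < p.sinrFun q z.1 z.2 ∧ p.exposure q z.1 ≤ w})
    ((measurableSet_lt measurable_const (p.measurable_sinrFun q)).inter
      (measurableSet_le ((p.measurable_exposure q).comp measurable_fst) measurable_const))
  have he : N.condJoint p P γ w q =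
      fun d => P.real {ω | γ < p.sinrFun q d (N.fading q ω, N.iu ω) ∧ p.exposure q d ≤ w} :=
    funext fun d => (N.condJoint_eq p P γ w q d).symm
  rw [he]
  exact h

variable (P p) (N) in
lemma condJoint_nonneg (γ w : ℝ) (q : LinkType) (d : Distances) : 0 ≤ N.condJoint p P γ w q d := by
  rw [← condJoint_eq]
  exact measureReal_nonneg

variable (P p) (N) in
lemma condJoint_le_one [IsProbabilityMeasure P] (γ w : ℝ) (q : LinkType) (d : Distances) :
    N.condJoint p P γ w q d ≤ 1 := by
  rw [← condJoint_eq]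
  exact measureReal_le_one

/-- The conditional probability, given the relevant distances, of an event that depends on these
distances, on the fading and on the interferers. -/
lemma IsModel.probGiven_ae_eq [IsProbabilityMeasure P] (hN : N.IsModel p P) (q : LinkType)
    {A : Set (Distances × (ℝ × Measure Interferer))} (hA : MeasurableSet A) :
    N.probGiven p P q {ω | (N.relDist p q ω, N.fading q ω, N.iu ω) ∈ A} =ᵐ[P]
      fun ω => P.real {ω' | (N.relDist p q ω, N.fading q ω', N.iu ω') ∈ A} := by
  have he : N.relDist p q = relevant q ∘ N.dist p := funext fun ω => N.relDist_eq p q ω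
  have hm : Measurable (N.relDist p q) := by
    rw [he]
    exact (measurable_relevant q).comp hN.measurable_serving.snd
  refine condExp_indicator_of_indepFun ?_ hm (hN.measurable_channel q) hA
  rw [he]
  exact (hN.indepFun_serving q).comp ((measurable_relevant q).comp measurable_snd) measurable_id

lemma IsModel.probGiven_sinr [IsProbabilityMeasure P] (hN : N.IsModel p P) (γ : ℝ) (q : LinkType) :
    N.probGiven p P q {ω | γ < N.sinrOf p q ω} =ᵐ[P]
      fun ω => N.condCoverage p P γ q (N.relDist p q ω) := by
  simp only [sinrOf_eq]
  exact hN.probGiven_ae_eq q (A := {z | γ < p.sinrFun q z.1 z.2})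
    (measurableSet_lt measurable_const (p.measurable_sinrFun q))

lemma IsModel.probGiven_exposure [IsProbabilityMeasure P] (hN : N.IsModel p P) (w : ℝ)
    (q : LinkType) :
    N.probGiven p P q {ω | N.exposureOf p q ω ≤ w} =ᵐ[P]
      fun ω => condCompliance p w q (N.relDist p q ω) := by
  simp only [exposureOf_eq]
  refine (hN.probGiven_ae_eq q (A := {z | p.exposure q z.1 ≤ w})
    (measurableSet_le ((p.measurable_exposure q).comp measurable_fst) measurable_const)).trans
    (.of_forall fun ω => ?_)
  by_cases h : p.exposure q (N.relDist p q ω) ≤ w <;> simp [h, condCompliance]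

lemma IsModel.probGiven_joint [IsProbabilityMeasure P] (hN : N.IsModel p P) (γ w : ℝ)
    (q : LinkType) :
    N.probGiven p P q {ω | γ < N.sinrOf p q ω ∧ N.exposureOf p q ω ≤ w} =ᵐ[P]
      fun ω => N.condJoint p P γ w q (N.relDist p q ω) := by
  simp only [sinrOf_eq, exposureOf_eq]
  refine (hN.probGiven_ae_eq q
    (A := {z | γ < p.sinrFun q z.1 z.2 ∧ p.exposure q z.1 ≤ w})
    ((measurableSet_lt measurable_const (p.measurable_sinrFun q)).inter
      (measurableSet_le ((p.measurable_exposure q).comp measurable_fst) measurable_const))).trans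
    (.of_forall fun ω => ?_)
  exact N.condJoint_eq p P γ w q _

end Network

/-! ## Averaging over the serving link -/

lemma integral_unif {a b : ℝ} (h : a < b) (f : ℝ → ℝ) :
    ∫ u, f u ∂(unif a b) = (b - a)⁻¹ * ∫ u in a..b, f u := by
  rw [unif, ProbabilityTheory.cond, integral_smul_measure, integral_Icc_eq_integral_Ioc,
    ← intervalIntegral.integral_of_le h.le, Real.volume_Icc, smul_eq_mul, ENNReal.toReal_inv,
    ENNReal.toReal_ofReal (sub_pos.2 h).le]

/-- The normalisation `probCL x` cancels, leaving `probNLoS x` times the unnormalised contact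
density. -/
lemma Params.assoc_CL_mul_pdfRU (p : Params) {x : ℝ} (h : p.probCL x ≠ 0) (y : ℝ) :
    p.assoc .CL x * p.pdfRU x y =
      p.probNLoS x * (p.lamR * (p.abar x y * y) *
        Real.exp (-∫ t in (0 : ℝ)..y, p.lamR * (p.abar x t * t))) := by
  rw [assoc, pdfRU, intervalIntegral.integral_const_mul]
  field_simp

lemma measurable_contactRIS_right (p : Params) (x : ℝ) : Measurable (contactRIS p x) :=
  Measurable.of_uncurry_left (f := contactRIS p) (measurable_contactRIS p)

lemma measurable_eligibleMass_right (p : Params) (x : ℝ) : Measurable (eligibleMass p x) :=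
  Measurable.of_uncurry_left (f := eligibleMass p) (measurable_eligibleMass p)

/-- A function of the RIS-user distance and the angle, on the event that there is a RIS with a
cascaded link. -/
def onContact (p : Params) (x : ℝ) (f : ℝ × ℝ → ℝ) (z : Measure RIS × ℝ) : ℝ :=
  {R | 0 < eligibleMass p x R}.indicator (fun R => f (contactRIS p x R, z.2)) z.1

lemma measurable_onContact (p : Params) (x : ℝ) {f : ℝ × ℝ → ℝ} (hf : Measurable f) :
    Measurable (onContact p x f) := by
  have hE : MeasurableSet {R | 0 < eligibleMass p x R} :=
    measurableSet_lt measurable_const (measurable_eligibleMass_right p x)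
  have hg : Measurable fun z : Measure RIS × ℝ => (contactRIS p x z.1, z.2) :=
    ((measurable_contactRIS_right p x).comp measurable_fst).prodMk measurable_snd
  exact (hf.comp hg).indicator (measurable_fst hE)

lemma abs_onContact_le (p : Params) (x : ℝ) {f : ℝ × ℝ → ℝ} {C : ℝ} (hC : ∀ z, |f z| ≤ C)
    (z : Measure RIS × ℝ) : |onContact p x f z| ≤ C := by
  have hC0 : 0 ≤ C := (abs_nonneg _).trans (hC 0)
  simp only [onContact, Set.indicator]
  split_ifs
  · exact hC _
  · simpa using hC0

namespace Network

variable {Ω : Type*} [MeasurableSpace Ω] {P : Measure Ω} {p : Params} {N : Network Ω}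

/-- The conditional joint probability of a link of type `q`, on the event that the serving link has
this type, as a function of the BS-user distance, the RISs, the LoS mark and the angle. -/
def servingJoint (N : Network Ω) (p : Params) (P : Measure Ω) (γ w : ℝ) (q : LinkType)
    (z : ℝ × Measure RIS × ℝ × ℝ) : ℝ :=
  if linkFun p z.1 z.2.1 z.2.2.1 = q
  then N.condJoint p P γ w q (distFun p z.1 z.2.1 z.2.2.2) else 0

lemma IsModel.measurable_servingJoint [IsProbabilityMeasure P] (hN : N.IsModel p P) (γ w : ℝ)
    (q : LinkType) :
    Measurable (N.servingJoint p P γ w q) := by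
  have h1 : Measurable fun z : ℝ × Measure RIS × ℝ × ℝ => (z.1, z.2.1, z.2.2.1) :=
    measurable_fst.prodMk (measurable_snd.fst.prodMk measurable_snd.snd.fst)
  have h2 : Measurable fun z : ℝ × Measure RIS × ℝ × ℝ => (z.1, z.2.1, z.2.2.2) :=
    measurable_fst.prodMk (measurable_snd.fst.prodMk measurable_snd.snd.snd)
  refine Measurable.ite ?_ ?_ measurable_const
  · exact ((measurable_linkFun p).comp h1) (MeasurableSet.of_discrete (s := {q}))
  · exact (hN.measurable_condJoint γ w q).comp ((measurable_distFun p).comp h2)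

lemma abs_servingJoint_le [IsProbabilityMeasure P] (γ w : ℝ) (q : LinkType)
    (z : ℝ × Measure RIS × ℝ × ℝ) :
    |N.servingJoint p P γ w q z| ≤ 1 := by
  unfold servingJoint
  split_ifs
  · rw [abs_of_nonneg (N.condJoint_nonneg p P _ _ _ _)]
    exact N.condJoint_le_one p P _ _ _ _
  · simp

lemma IsModel.measurable_marks (hN : N.IsModel p P) :
    Measurable fun ω => (N.ris ω, N.mark ω, N.theta ω) :=
  hN.ris_poisson.measurable.prodMk (hN.mark_measurable.prodMk hN.theta_measurable)

/-- The joint probability on the event that the serving link has type `q`, averaged over the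
BS-user distance. -/
lemma IsModel.real_link_eq [IsProbabilityMeasure P] (hN : N.IsModel p P) (γ w : ℝ) (q : LinkType) :
    P.real {ω | N.link p ω = q ∧ γ < N.sinrOf p q ω ∧ N.exposureOf p q ω ≤ w} =
      ∫ x, ∫ ω, N.servingJoint p P γ w q (x, N.ris ω, N.mark ω, N.theta ω) ∂P ∂(P.map N.tbu) := by
  have hs : MeasurableSet {z : LinkType × Distances | z.1 = q} :=
    measurable_fst (MeasurableSet.of_discrete (s := {q}))
  -- First average out the channel with type and distances frozen; what is left depends on `tbu`,
  -- the RISs, the mark and the angle, and `tbu` is independent of the others.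
  have h1 := setIntegral_real_section (hN.indepFun_serving q) hN.measurable_serving
    (hN.measurable_channel q)
    (A := {z : (LinkType × Distances) × (ℝ × Measure Interferer) |
      γ < p.sinrFun q z.1.2 z.2 ∧ p.exposure q z.1.2 ≤ w})
    ((measurableSet_lt measurable_const ((p.measurable_sinrFun q).comp
        (measurable_fst.snd.prodMk measurable_snd))).inter
      (measurableSet_le ((p.measurable_exposure q).comp measurable_fst.snd) measurable_const)) hs
  refine Eq.trans (Eq.trans ?_ h1) ?_
  · rfl
  · rw [← integral_indepFun hN.indepFun_tbu hN.measurable_tbu hN.measurable_marks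
      (hN.measurable_servingJoint γ w q) (abs_servingJoint_le γ w q),
      ← integral_indicator (hN.measurable_serving hs)]
    refine integral_congr_ae (.of_forall fun ω => ?_)
    simp only [Set.indicator, Set.mem_preimage, Set.mem_ofPred_eq, servingJoint, ← hN.link_eq,
      ← hN.dist_eq, condJoint_eq]

lemma IsModel.integrable_servingJoint [IsProbabilityMeasure P] (hN : N.IsModel p P) (γ w : ℝ)
    (q : LinkType) :
    Integrable (fun x => ∫ ω, N.servingJoint p P γ w q (x, N.ris ω, N.mark ω, N.theta ω) ∂P)
      (P.map N.tbu) :=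
  integrable_integral_indepFun hN.measurable_tbu hN.measurable_marks
    (hN.measurable_servingJoint γ w q) (abs_servingJoint_le γ w q)

/-! ### Contribution of each link type at a fixed BS-user distance -/

lemma IsModel.real_mark_le (hN : N.IsModel p P) {x : ℝ} (hx : 0 < x) :
    P.real {ω | N.mark ω ≤ p.probLoS x} = p.probLoS x := by
  have h := Measure.map_apply (μ := P) hN.mark_measurable (measurableSet_Iic (a := p.probLoS x))
  rw [hN.mark_law, unif_zero_one_Iic (p.probLoS_le_one hx.le)] at h
  rw [Measure.real]
  exact (congrArg ENNReal.toReal h.symm).trans (ENNReal.toReal_ofReal (p.probLoS_pos x).le)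

lemma IsModel.real_lt_mark [IsProbabilityMeasure P] (hN : N.IsModel p P) {x : ℝ} (hx : 0 < x) :
    P.real {ω | p.probLoS x < N.mark ω} = p.probNLoS x := by
  have hm : MeasurableSet {ω | N.mark ω ≤ p.probLoS x} :=
    measurableSet_le hN.mark_measurable measurable_const
  have h := probReal_compl_eq_one_sub (μ := P) hm
  rw [hN.real_mark_le hx] at h
  rw [Params.probNLoS, ← h]
  congr 1
  ext ω
  simp

/-- The void probability of the whole eligible set, whose intensity is finite; `probCL` is its
complement. -/
lemma IsModel.real_no_eligible (hN : N.IsModel p P) {x : ℝ} (hx : 0 < x) :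
    P.real {ω | N.ris ω (eligible p x) = 0} = 1 - p.probCL x := by
  have hΛ := risIntensity_eligible_univ p hx
  have h := hN.ris_poisson.measure_void (measurableSet_eligible p x)
    (by rw [← risIntensity, hΛ]; simp)
  rw [← risIntensity, hΛ, ENNReal.toReal_ofReal] at h
  · rw [Measure.real, h, ENNReal.toReal_ofReal (Real.exp_nonneg _), Params.probCL]
    simp
  · exact mul_nonneg p.lamR_nonneg (setIntegral_nonneg measurableSet_Ioi fun t ht =>
      mul_nonneg (p.abar_nonneg x t) (le_of_lt ht))

lemma IsModel.integral_servingJoint_DL [IsProbabilityMeasure P] (hN : N.IsModel p P)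
    (γ w : ℝ) {x : ℝ} (hx : 0 < x) :
    ∫ ω, N.servingJoint p P γ w .DL (x, N.ris ω, N.mark ω, N.theta ω) ∂P =
      p.assoc .DL x * N.condJoint p P γ w .DL (x, 0, 0) := by
  have hm : MeasurableSet {ω | N.mark ω ≤ p.probLoS x} :=
    measurableSet_le hN.mark_measurable measurable_const
  have he : ∀ ω, N.servingJoint p P γ w .DL (x, N.ris ω, N.mark ω, N.theta ω) =
      {ω | N.mark ω ≤ p.probLoS x}.indicator
        (fun _ => N.condJoint p P γ w .DL (x, 0, 0)) ω := by
    intro ω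
    -- On a direct link only the first distance enters, so the other two can be reset to 0
    -- definitionally.
    have hJ : N.condJoint p P γ w .DL (distFun p x (N.ris ω) (N.theta ω)) =
        N.condJoint p P γ w .DL (x, 0, 0) := rfl
    simp only [servingJoint, hJ, Set.indicator, Set.mem_ofPred_eq]
    by_cases h1 : N.mark ω ≤ p.probLoS x
    · simp [linkFun, h1]
    · by_cases h2 : 0 < eligibleMass p x (N.ris ω) <;> simp [linkFun, h1, h2]
  simp only [he]
  rw [integral_indicator hm, setIntegral_const, hN.real_mark_le hx]
  rfl

/-- Blockage of the direct link is independent of the RISs and the angle, so it contributes the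
factor `probNLoS x`. -/
lemma IsModel.integral_indicator_mark_mul [IsProbabilityMeasure P] (hN : N.IsModel p P) {x : ℝ}
    (hx : 0 < x)
    {k : Measure RIS × ℝ → ℝ} (hk : Measurable k) :
    ∫ ω, {ω | p.probLoS x < N.mark ω}.indicator (fun _ => (1 : ℝ)) ω * k (N.ris ω, N.theta ω) ∂P =
      p.probNLoS x * ∫ ω, k (N.ris ω, N.theta ω) ∂P := by
  have hf : Measurable ((Set.Ioi (p.probLoS x)).indicator fun _ => (1 : ℝ)) :=
    measurable_const.indicator measurableSet_Ioi
  have h := (hN.indepFun_mark.comp hf hk).integral_mul_eq_mul_integral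
    (hf.comp hN.mark_measurable).aestronglyMeasurable
    (hk.comp (hN.ris_poisson.measurable.prodMk hN.theta_measurable)).aestronglyMeasurable
  have hm : MeasurableSet {ω | p.probLoS x < N.mark ω} :=
    measurableSet_lt measurable_const hN.mark_measurable
  have h1 : ∫ ω, ((Set.Ioi (p.probLoS x)).indicator fun _ => (1 : ℝ)) (N.mark ω) ∂P =
      p.probNLoS x := by
    rw [← hN.real_lt_mark hx, ← integral_indicator_one hm]
    rfl
  simp only [Function.comp_def] at h
  rw [h1] at h
  exact h

lemma IsModel.integral_servingJoint_DN [IsProbabilityMeasure P] (hN : N.IsModel p P)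
    (γ w : ℝ) {x : ℝ} (hx : 0 < x) :
    ∫ ω, N.servingJoint p P γ w .DN (x, N.ris ω, N.mark ω, N.theta ω) ∂P =
      p.assoc .DN x * N.condJoint p P γ w .DN (x, 0, 0) := by
  set k : Measure RIS × ℝ → ℝ := fun z =>
    {R | eligibleMass p x R = 0}.indicator (fun _ => N.condJoint p P γ w .DN (x, 0, 0)) z.1 with hk
  have hE : MeasurableSet {R | eligibleMass p x R = 0} :=
    measurable_eligibleMass_right p x (measurableSet_singleton 0)
  have hkm : Measurable k := (measurable_const.indicator hE).comp measurable_fst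
  have he : ∀ ω, N.servingJoint p P γ w .DN (x, N.ris ω, N.mark ω, N.theta ω) =
      {ω | p.probLoS x < N.mark ω}.indicator (fun _ => (1 : ℝ)) ω * k (N.ris ω, N.theta ω) := by
    intro ω
    have hJ : N.condJoint p P γ w .DN (distFun p x (N.ris ω) (N.theta ω)) =
        N.condJoint p P γ w .DN (x, 0, 0) := rfl
    simp only [servingJoint, hJ, hk, Set.indicator, Set.mem_ofPred_eq]
    by_cases h1 : N.mark ω ≤ p.probLoS x
    · simp [linkFun, h1]
    · by_cases h2 : eligibleMass p x (N.ris ω) = 0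
      · simp [linkFun, h1, h2, not_le.1 h1]
      · simp [linkFun, h1, h2, pos_iff_ne_zero.2 h2]
  simp only [he]
  have hm : MeasurableSet {ω | N.ris ω (eligible p x) = 0} :=
    hN.ris_poisson.measurable_apply (measurableSet_eligible p x) (measurableSet_singleton 0)
  have hki : ∫ ω, k (N.ris ω, N.theta ω) ∂P =
      (1 - p.probCL x) * N.condJoint p P γ w .DN (x, 0, 0) := by
    rw [← hN.real_no_eligible hx, ← smul_eq_mul, ← setIntegral_const, ← integral_indicator hm]
    refine integral_congr_ae (.of_forall fun ω => ?_)
    simp only [hk, Set.indicator, Set.mem_ofPred_eq, hN.eligibleMass_ris]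
  rw [hN.integral_indicator_mark_mul hx hkm, hki, Params.assoc, mul_assoc]

/-- With the RISs frozen, averaging over the independent uniform angle leaves a function of the
contact distance alone; the Poisson contact law then applies. -/
lemma IsModel.integral_contact [IsProbabilityMeasure P] (hN : N.IsModel p P) {x : ℝ} (hx : 0 < x)
    {f : ℝ × ℝ → ℝ} (hf : Measurable f) {C : ℝ} (hC : ∀ z, |f z| ≤ C) :
    ∫ ω, onContact p x f (N.ris ω, N.theta ω) ∂P =
      ∫ y in Set.Ioi (0 : ℝ), ((2 * Real.pi)⁻¹ * ∫ θ in (-Real.pi)..Real.pi, f (y, θ)) *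
        (p.lamR * (p.abar x y * y) *
          Real.exp (-∫ t in (0 : ℝ)..y, p.lamR * (p.abar x t * t))) := by
  have hkm := measurable_onContact p x hf
  have h1 := integral_indepFun hN.indepFun_ris_theta hN.ris_poisson.measurable hN.theta_measurable
    hkm (abs_onContact_le p x hC)
  set F : ℝ → ℝ := fun y => (2 * Real.pi)⁻¹ * ∫ θ in (-Real.pi)..Real.pi, f (y, θ) with hF
  have hFint : ∀ y, ∫ ω, f (y, N.theta ω) ∂P = F y := by
    intro y
    have h2 := integral_unif (show -Real.pi < Real.pi by linarith [Real.pi_pos])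
      (fun θ => f (y, θ))
    rw [← hN.theta_law, integral_map hN.theta_measurable.aemeasurable
      (f := fun θ => f (y, θ)) (hf.comp measurable_prodMk_left).aestronglyMeasurable] at h2
    rw [h2, hF]
    congr 2
    ring
  have hFm : Measurable F := by
    simp only [← funext hFint]
    exact measurable_integral_section hN.theta_measurable hf
  have hm : MeasurableSet {ω | 0 < N.ris ω (eligible p x)} :=
    measurableSet_lt measurable_const
      (hN.ris_poisson.measurable_apply (measurableSet_eligible p x))
  have h5 := hN.ris_poisson.setIntegral_firstContact measurable_fst (measurableSet_eligible p x)
    (g := fun t => p.lamR * (p.abar x t * t))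
    (continuous_const.mul ((p.continuous_abar hx).mul continuous_id))
    (fun t ht => mul_nonneg p.lamR_nonneg (mul_nonneg (p.abar_nonneg x t) ht))
    (fun r hr => risIntensity_eligible_Iic p hx hr) hFm
  rw [← h5, ← integral_indicator hm]
  refine h1.trans ?_
  have h6 := measurable_integral_section (P := P) hN.theta_measurable hkm
  rw [integral_map hN.ris_poisson.measurable.aemeasurable h6.aestronglyMeasurable]
  refine integral_congr_ae (.of_forall fun ω => ?_)
  by_cases h : 0 < N.ris ω (eligible p x)
  · simp only [onContact, Set.indicator, Set.mem_ofPred_eq, hN.eligibleMass_ris, h, if_true,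
      hN.contactRIS_ris, hFint]
  · simp [onContact, Set.indicator, hN.eligibleMass_ris, h]

lemma IsModel.integral_servingJoint_CL [IsProbabilityMeasure P] (hN : N.IsModel p P)
    (γ w : ℝ) {x : ℝ} (hx : 0 < x) :
    ∫ ω, N.servingJoint p P γ w .CL (x, N.ris ω, N.mark ω, N.theta ω) ∂P =
      ∫ y in Set.Ioi (0 : ℝ), ∫ θ in (-Real.pi)..Real.pi,
        p.assoc .CL x * N.condJoint p P γ w .CL (x, y, Params.distBR x y θ) *
          (1 / (2 * Real.pi) * p.pdfRU x y) := by
  set f : ℝ × ℝ → ℝ := fun z => N.condJoint p P γ w .CL (x, z.1, Params.distBR x z.1 z.2) with hf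
  have hfm : Measurable f := by
    have h1 : Measurable fun z : ℝ × ℝ => Params.distBR x z.1 z.2 :=
      measurable_distBR.comp measurable_prodMk_left
    exact (hN.measurable_condJoint γ w .CL).comp
      (measurable_const.prodMk (measurable_fst.prodMk h1))
  have hfC : ∀ z, |f z| ≤ 1 := fun z => by
    rw [abs_of_nonneg (N.condJoint_nonneg p P _ _ _ _)]
    exact N.condJoint_le_one p P _ _ _ _
  have hkm := measurable_onContact p x hfm
  have he : ∀ ω, N.servingJoint p P γ w .CL (x, N.ris ω, N.mark ω, N.theta ω) =
      {ω | p.probLoS x < N.mark ω}.indicator (fun _ => (1 : ℝ)) ω *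
        onContact p x f (N.ris ω, N.theta ω) := by
    intro ω
    have hJ : N.condJoint p P γ w .CL (distFun p x (N.ris ω) (N.theta ω)) =
        f (contactRIS p x (N.ris ω), N.theta ω) := rfl
    simp only [servingJoint, hJ, onContact, Set.indicator, Set.mem_ofPred_eq]
    by_cases h1 : N.mark ω ≤ p.probLoS x
    · simp [linkFun, h1]
    · by_cases h2 : 0 < eligibleMass p x (N.ris ω)
      · simp [linkFun, h1, h2, not_le.1 h1]
      · simp [linkFun, h1, h2]
  simp only [he]
  rw [hN.integral_indicator_mark_mul hx hkm]
  -- When `probCL x = 0` the cancellation in `pdfRU` is unavailable, but almost surely no RIS is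
  -- eligible and `assoc .CL x` is 0, so both sides vanish.
  by_cases hCL : p.probCL x = 0
  · have h0 : ∀ᵐ ω ∂P, onContact p x f (N.ris ω, N.theta ω) = 0 := by
      have h1 := hN.real_no_eligible hx
      rw [hCL, sub_zero] at h1
      have hm : MeasurableSet {ω | N.ris ω (eligible p x) = 0} :=
        hN.ris_poisson.measurable_apply (measurableSet_eligible p x) (measurableSet_singleton 0)
      have h2 : ∀ᵐ ω ∂P, N.ris ω (eligible p x) = 0 := by
        refine (mem_ae_iff_prob_eq_one hm).2 ?_
        rw [← ENNReal.toReal_eq_one_iff]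
        exact h1
      filter_upwards [h2] with ω hω
      simp [onContact, hN.eligibleMass_ris, hω]
    rw [integral_eq_zero_of_ae h0]
    simp [Params.assoc, hCL]
  · have h1 := hN.integral_contact hx hfm hfC
    rw [h1, ← integral_const_mul]
    refine setIntegral_congr_fun measurableSet_Ioi fun y _ => ?_
    have h3 := p.assoc_CL_mul_pdfRU hCL y
    have h4 : ∀ θ, p.assoc .CL x * N.condJoint p P γ w .CL (x, y, Params.distBR x y θ) *
        (1 / (2 * Real.pi) * p.pdfRU x y) =
        ((2 * Real.pi)⁻¹ * (p.assoc .CL x * p.pdfRU x y)) * f (y, θ) := fun θ => by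
      simp only [hf]
      ring
    simp only [h4]
    refine Eq.trans ?_ (intervalIntegral.integral_const_mul _ _).symm
    rw [h3]
    ring

/-! ### Summation over the link types -/

lemma setOf_sinr_emfe {Ω : Type*} (N : Network Ω) (p : Params) (γ w : ℝ) :
    {ω | γ < N.sinr p ω ∧ N.emfe p ω ≤ w} =
      ({ω | N.link p ω = .DL ∧ γ < N.sinrOf p .DL ω ∧ N.exposureOf p .DL ω ≤ w} ∪
        {ω | N.link p ω = .CL ∧ γ < N.sinrOf p .CL ω ∧ N.exposureOf p .CL ω ≤ w}) ∪
        {ω | N.link p ω = .DN ∧ γ < N.sinrOf p .DN ω ∧ N.exposureOf p .DN ω ≤ w} := by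
  ext ω
  simp only [sinr, emfe, Set.mem_union, Set.mem_ofPred_eq]
  cases h : N.link p ω <;> simp

lemma IsModel.measurableSet_link_event (hN : N.IsModel p P) (γ w : ℝ) (q : LinkType) :
    MeasurableSet {ω | N.link p ω = q ∧ γ < N.sinrOf p q ω ∧ N.exposureOf p q ω ≤ w} := by
  have hd := hN.measurable_serving.snd
  have h1 : Measurable (N.sinrOf p q) := by
    have h := (p.measurable_sinrFun q).comp (hd.prodMk (hN.measurable_channel q))
    exact h
  have h2 : Measurable (N.exposureOf p q) := by
    have h := (p.measurable_exposure q).comp hd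
    exact h
  exact (hN.measurable_serving.fst (MeasurableSet.of_discrete (s := {q}))).inter
    ((measurableSet_lt measurable_const h1).inter (measurableSet_le h2 measurable_const))

lemma IsModel.integral_map_tbu [IsProbabilityMeasure P] (hN : N.IsModel p P) (f : ℝ → ℝ) :
    ∫ x, f x ∂(P.map N.tbu) = ∫ x in Set.Ioi (0 : ℝ), f x * p.pdfBU x := by
  have hm : Measurable p.pdfBU := by
    unfold Params.pdfBU
    fun_prop
  rw [hN.map_tbu, integral_withDensity_eq_integral_toReal_smul hm.ennreal_ofReal (by simp)]
  refine setIntegral_congr_fun measurableSet_Ioi fun x hx => ?_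
  have hx' : 0 < x := hx
  have : 0 ≤ p.pdfBU x := by
    have := p.lamB_pos
    have := Real.pi_pos
    unfold Params.pdfBU
    positivity
  simp only [ENNReal.toReal_ofReal this, smul_eq_mul, mul_comm]

lemma IsModel.real_sinr_emfe [IsProbabilityMeasure P] (hN : N.IsModel p P) (γ w : ℝ) :
    P.real {ω | γ < N.sinr p ω ∧ N.emfe p ω ≤ w} =
      ∫ x in Set.Ioi (0 : ℝ),
        (p.assoc .DL x * N.condJoint p P γ w .DL (x, 0, 0) +
          (∫ y in Set.Ioi (0 : ℝ), ∫ θ in (-Real.pi)..Real.pi,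
            p.assoc .CL x * N.condJoint p P γ w .CL (x, y, Params.distBR x y θ) *
              (1 / (2 * Real.pi) * p.pdfRU x y)) +
          p.assoc .DN x * N.condJoint p P γ w .DN (x, 0, 0)) * p.pdfBU x := by
  have hm := hN.measurableSet_link_event γ w
  rw [N.setOf_sinr_emfe, measureReal_union ?_ (hm .DN), measureReal_union ?_ (hm .CL),
    hN.real_link_eq, hN.real_link_eq, hN.real_link_eq,
    ← integral_add' (hN.integrable_servingJoint γ w .DL) (hN.integrable_servingJoint γ w .CL),
    ← integral_add' ((hN.integrable_servingJoint γ w .DL).add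
      (hN.integrable_servingJoint γ w .CL)) (hN.integrable_servingJoint γ w .DN),
    hN.integral_map_tbu]
  -- The three fixed-distance formulas need `x > 0`, which holds on the domain of integration.
  · refine setIntegral_congr_fun measurableSet_Ioi fun x hx => ?_
    simp only [Pi.add_apply]
    rw [hN.integral_servingJoint_DL γ w hx, hN.integral_servingJoint_CL γ w hx,
      hN.integral_servingJoint_DN γ w hx]
  · refine Set.disjoint_left.2 fun ω h1 h2 => ?_
    have := h1.1.symm.trans h2.1
    simp at this
  · refine Set.disjoint_left.2 fun ω h1 h2 => ?_
    rcases h1 with h1 | h1 <;>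
    · have := h1.1.symm.trans h2.1
      simp at this

end Network

end

end RISNet

theorem theorem6 {Ω : Type*} [MeasurableSpace Ω] (P : Measure Ω) [IsProbabilityMeasure P]
    (p : RISNet.Params) (N : RISNet.Network Ω) (hN : N.IsModel p P) (γ w : ℝ) :
    (∀ q, N.probGiven p P q {ω | γ < N.sinrOf p q ω} =ᵐ[P]
        fun ω => N.condCoverage p P γ q (N.relDist p q ω)) ∧
    (∀ q, N.probGiven p P q {ω | N.exposureOf p q ω ≤ w} =ᵐ[P]
        fun ω => RISNet.Network.condCompliance p w q (N.relDist p q ω)) ∧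
    (∀ q, N.probGiven p P q {ω | γ < N.sinrOf p q ω ∧ N.exposureOf p q ω ≤ w} =ᵐ[P]
        fun ω => N.condJoint p P γ w q (N.relDist p q ω)) ∧
    P.real {ω | γ < N.sinr p ω ∧ N.emfe p ω ≤ w} =
      ∫ tbu in Set.Ioi (0 : ℝ),
        (p.assoc .DL tbu * N.condJoint p P γ w .DL (tbu, 0, 0) +
          (∫ tru in Set.Ioi (0 : ℝ), ∫ θ in (-Real.pi)..Real.pi,
            p.assoc .CL tbu *
              N.condJoint p P γ w .CL (tbu, tru, RISNet.Params.distBR tbu tru θ) *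
              (1 / (2 * Real.pi) * p.pdfRU tbu tru)) +
          p.assoc .DN tbu * N.condJoint p P γ w .DN (tbu, 0, 0)) * p.pdfBU tbu :=
  ⟨hN.probGiven_sinr γ, hN.probGiven_exposure w, hN.probGiven_joint γ w, hN.real_sinr_emfe γ w⟩
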